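/- Functions are complex valued, and $[0,1]^d$ is regarded as the $d$-dimensional torus $(\mathbb R/\mathbb Z)^d$ with Lebesgue measure. Let $\mathbf a=(a_j)_{j\ge1}$ and $\mathbf b=(b_j)_{j\ge1}$ be sequences of positive numbers with $a_1\le a_2\le\cdots$ and $\inf_{j\ge1}b_j>0$. For $d\in\mathbb N=\{1,2,\dots\}$ let $$W_2^{\mathbf a,\mathbf b}([0,1]^d)=\{f\in L_2([0,1]^d): D_j^{b_j}f\in L_2([0,1]^d),\ j=1,\dots,d\},\qquad \|f\|_{W_2^{\mathbf a,\mathbf b}}=\Big(\|f\|_2^2+\sum_{j=1}^d\frac{a_j}{(2\pi)^{2b_j}}\|D_j^{b_j}f\|_2^2\Big)^{1/2},$$ where, for $r>0$, $D_j^rf=\sum_{k\in\mathbb Z^d}(2\pi i k_j)^r\hat f(k)e^{2\pi i k\cdot x}$ is the Weyl derivative, with $(2\pi i m)^r=|2\pi m|^r\exp(\tfrac{r\pi i}{2}\operatorname{sign}m)$, and let $I_d:W_2^{\mathbf a,\mathbf b}([0,1]^d)\to L_2([0,1]^d)$ be the embedding $I_df=f$. Let $F_d$ be the unit ball of $W_2^{\mathbf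 a,\mathbf b}([0,1]^d)$. For $n\ge1$ let $e(n,I_d)=\inf_A\sup_{f\in F_d}\|f-A(f)\|_2$, the infimum being over all $A(f)=\varphi(L_1(f),\dots,L_n(f))$ with continuous linear functionals $L_i$ on $W_2^{\mathbf a,\mathbf b}([0,1]^d)$ and an arbitrary map $\varphi:\mathbb C^n\to L_2([0,1]^d)$; for $n=0$ only $A=0$ is used. For $\varepsilon\in(0,1)$ put $n(\varepsilon,d)=\min\{n\ge0: e(n,I_d)\le\varepsilon\}$. The problem $I=\{I_d\}_{d\in\mathbb N}$ is called - SPT if there are $C,p\ge0$ with $n(\varepsilon,d)\le C\varepsilon^{-p}$ for all $d\in\mathbb N$, $\varepsilon\in(0,1)$; - PT if there are $C,p,q\ge0$ with $n(\varepsilon,d)\le Cd^q\varepsilon^{-p}$ for all $d\in\mathbb N$, $\varepsilon\in(0,1)$; - QPT if there are $C,t>0$ with $n(\varepsilon,d)\le C\exp[t(1+\ln\varepsilon^{-1})(1+\ln d)]$ for all $d\in\mathbb N$, $\varepsilon\in(0,1)$; - $(s,t)$-WT, for fixed $s,t>0$, if $\lim_{\varepsilon^{-1}+d\to\infty}\dfrac{\ln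 n(\varepsilon,d)}{\varepsilon^{-s}+d^t}=0$ (the limit over $\varepsilon\in(0,1)$, $d\in\mathbb N$); - WT if $\lim_{\varepsilon^{-1}+d\to\infty}\dfrac{\ln n(\varepsilon,d)}{\varepsilon^{-1}+d}=0$, and UWT if $\lim_{\varepsilon^{-1}+d\to\infty}\dfrac{\ln n(\varepsilon,d)}{\varepsilon^{-\alpha}+d^{\beta}}=0$ for all $\alpha,\beta>0$. **Theorem.** Under these assumptions the minimum defining $n(\varepsilon,d)$ exists for all $\varepsilon\in(0,1)$ and $d\in\mathbb N$, and the following hold for $I$. 1. SPT holds iff PT holds iff $\sum_{j=1}^\infty b_j^{-1}<\infty$ and $\liminf_{j\to\infty}\frac{\ln a_j}{j}>0$. 2. QPT holds iff $\sup_{d\in\mathbb N}\frac{\sum_{j=1}^d b_j^{-1}}{1+\ln d}<\infty$ and $\liminf_{j\to\infty}\frac{(1+\ln j)\ln a_j}{j}>0$. 3. UWT holds iff $\lim_{j\to\infty}\frac{\ln a_j}{\ln j}=\infty$. 4. WT holds iff $\lim_{j\to\infty}\frac{a_j}{j}=\infty$. 5. $(s,t)$-WT holds for all $s,t>0$ with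 $\max(s/2,t)>1$. 6. $(2,1)$-WT holds iff $\lim_{j\to\infty}a_j=\infty$. 7. For every $0<t<1$, $(2,t)$-WT holds iff $\lim_{j\to\infty}\frac{a_j}{\ln j}=\infty$. 8. For all $0<s<2$ and $0<t\le1$, $(s,t)$-WT holds iff $\lim_{j\to\infty}\frac{a_j}{j^{(2-s)/s}}=\infty$. -/

import Mathlib

open Filter Topology MeasureTheory
open scoped ENNReal

namespace SobolevTractability

noncomputable section

/-! ### The space `L₂([0,1]^d)`

The cube `[0,1]^d` is regarded as the torus `(ℝ/ℤ)^d` with its normalized Haar (= Lebesgue)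
measure; functions are complex valued.  Fourier coefficients are Mathlib's
`UnitAddTorus.mFourierCoeff f k = ∫ exp (-2πi k·x) f x dx`. -/

/-- Lebesgue measure of total mass one on the `d`-dimensional unit torus. -/
abbrev torusMeasure (d : ℕ) : Measure (UnitAddTorus (Fin d)) :=
  Measure.pi fun _ => AddCircle.haarAddCircle

/-- `L₂([0,1]^d)`, complex valued. -/
abbrev L2Torus (d : ℕ) : Type := Lp ℂ 2 (torusMeasure d)

/-- Fourier coefficients of an element of `L₂([0,1]^d)`. -/
def fourierCoeffL2 {d : ℕ} (f : L2Torus d) (k : Fin d → ℤ) : ℂ :=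
  UnitAddTorus.mFourierCoeff (f : UnitAddTorus (Fin d) → ℂ) k

theorem fourierCoeffL2_eq_repr {d : ℕ} (f : L2Torus d) (k : Fin d → ℤ) :
    fourierCoeffL2 f k = UnitAddTorus.mFourierBasis.repr f k :=
  (UnitAddTorus.mFourierBasis_repr f k).symm

theorem fourierCoeffL2_add {d : ℕ} (f g : L2Torus d) (k : Fin d → ℤ) :
    fourierCoeffL2 (f + g) k = fourierCoeffL2 f k + fourierCoeffL2 g k := by
  simp only [fourierCoeffL2_eq_repr]
  erw [map_add]
  rfl

theorem fourierCoeffL2_smul {d : ℕ} (c : ℂ) (f : L2Torus d) (k : Fin d → ℤ) :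
    fourierCoeffL2 (c • f) k = c * fourierCoeffL2 f k := by
  simp only [fourierCoeffL2_eq_repr]
  erw [map_smul]
  rfl

theorem fourierCoeffL2_injective {d : ℕ} {f g : L2Torus d}
    (h : ∀ k, fourierCoeffL2 f k = fourierCoeffL2 g k) : f = g := by
  apply UnitAddTorus.mFourierBasis.repr.injective
  ext k
  have := h k
  rwa [fourierCoeffL2_eq_repr, fourierCoeffL2_eq_repr] at this

/-! ### Weyl derivatives -/

/-- The number `(2πik)^r = |2πk|^r exp((rπi/2) sign k)`. -/
def weylSymbol (r : ℝ) (k : ℤ) : ℂ :=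
  ((|2 * Real.pi * (k : ℝ)| ^ r : ℝ) : ℂ) *
    Complex.exp ((r : ℂ) * Real.pi * Complex.I / 2 * (k.sign : ℂ))

/-- `g ∈ L₂` is the partial derivative `D_j^r f` of order `r` in the sense of Weyl:
`D_j^r f = ∑ₖ (2πi k_j)^r f̂(k) exp(2πi k·x)`. -/
def IsWeylDeriv {d : ℕ} (j : Fin d) (r : ℝ) (f g : L2Torus d) : Prop :=
  ∀ k : Fin d → ℤ, fourierCoeffL2 g k = weylSymbol r (k j) * fourierCoeffL2 f k

theorem IsWeylDeriv.unique {d : ℕ} {j : Fin d} {r : ℝ} {f g g' : L2Torus d}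
    (h : IsWeylDeriv j r f g) (h' : IsWeylDeriv j r f g') : g = g' :=
  fourierCoeffL2_injective fun k => (h k).trans (h' k).symm

theorem IsWeylDeriv.add {d : ℕ} {j : Fin d} {r : ℝ} {f f' g g' : L2Torus d}
    (h : IsWeylDeriv j r f g) (h' : IsWeylDeriv j r f' g') :
    IsWeylDeriv j r (f + f') (g + g') := fun k => by
  rw [fourierCoeffL2_add, fourierCoeffL2_add, h k, h' k, mul_add]

theorem IsWeylDeriv.smul {d : ℕ} {j : Fin d} {r : ℝ} {f g : L2Torus d} (c : ℂ)
    (h : IsWeylDeriv j r f g) : IsWeylDeriv j r (c • f) (c • g) := fun k => by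
  rw [fourierCoeffL2_smul, fourierCoeffL2_smul, h k]
  ring

/-! ### Weighted anisotropic Sobolev spaces

Sequences `a₁, a₂, …` are functions `ℕ → ℝ` whose value at `0` is never used; the coordinate
`j : Fin d` (numbered from `0`) belongs to the parameters `a (j + 1)` and `b (j + 1)`. -/

/-- The set `{f ∈ L₂ : D_j^{b_j} f ∈ L₂, j = 1, …, d}`. -/
def sobolevSubmodule (b : ℕ → ℝ) (d : ℕ) : Submodule ℂ (L2Torus d) where
  carrier := {f | ∀ j : Fin d, ∃ g : L2Torus d, IsWeylDeriv j (b ((j : ℕ) + 1)) f g}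
  add_mem' := fun hf hf' j => by
    obtain ⟨g, hg⟩ := hf j
    obtain ⟨g', hg'⟩ := hf' j
    exact ⟨g + g', hg.add hg'⟩
  zero_mem' := fun j => ⟨(0 : ℂ) • (0 : L2Torus d), fun k => by
    have h : fourierCoeffL2 (0 : L2Torus d) k = 0 := by
      simpa using fourierCoeffL2_smul 0 (0 : L2Torus d) k
    rw [fourierCoeffL2_smul, h]
    simp⟩
  smul_mem' := fun c _ hf j => by
    obtain ⟨g, hg⟩ := hf j
    exact ⟨c • g, hg.smul c⟩

/-- The Sobolev space `W_2^{a,b}([0,1]^d)`.  It is a copy of `sobolevSubmodule b d` (and not that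
subspace itself) because it carries its own norm; see `SobolevSpace.norm_eq`. -/
def SobolevSpace (_a b : ℕ → ℝ) (d : ℕ) : Type := sobolevSubmodule b d

namespace SobolevSpace

variable (a b : ℕ → ℝ) (d : ℕ)

instance : AddCommGroup (SobolevSpace a b d) :=
  inferInstanceAs (AddCommGroup (sobolevSubmodule b d))

instance : Module ℂ (SobolevSpace a b d) :=
  inferInstanceAs (Module ℂ (sobolevSubmodule b d))

/-- The identity, as a linear map from `W_2^{a,b}` to `L₂`. -/
def toL2 : SobolevSpace a b d →ₗ[ℂ] L2Torus d := (sobolevSubmodule b d).subtype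

theorem toL2_injective : Function.Injective (toL2 a b d) := Subtype.val_injective

/-- The derivative `f ↦ D_j^{b_j} f` on `W_2^{a,b}`. -/
def weylDeriv (j : Fin d) : SobolevSpace a b d →ₗ[ℂ] L2Torus d where
  toFun f := Classical.choose (f.2 j)
  map_add' f g := (Classical.choose_spec ((f + g).2 j)).unique
    ((Classical.choose_spec (f.2 j)).add (Classical.choose_spec (g.2 j)))
  map_smul' c f := (Classical.choose_spec ((c • f).2 j)).unique
    ((Classical.choose_spec (f.2 j)).smul c)

theorem isWeylDeriv_weylDeriv (j : Fin d) (f : SobolevSpace a b d) :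
    IsWeylDeriv j (b (j + 1)) (toL2 a b d f) (weylDeriv a b d j f) :=
  Classical.choose_spec (f.2 j)

/-- `f ↦ (f, (√a_j (2π)^{-b_j} D_j^{b_j} f)_j)`, from `W_2^{a,b}` into the Hilbert sum of `d + 1`
copies of `L₂`.  The norm of `W_2^{a,b}` is the norm of this vector. -/
def graphMap :
    SobolevSpace a b d →ₗ[ℂ] WithLp 2 (L2Torus d × PiLp 2 fun _ : Fin d => L2Torus d) where
  toFun f := WithLp.toLp 2 (toL2 a b d f, WithLp.toLp 2 fun j : Fin d =>
    ((√(a (j + 1)) / (2 * Real.pi) ^ b (j + 1) : ℝ) : ℂ) • weylDeriv a b d j f)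
  map_add' f g := by
    simp only [map_add, smul_add]
    rfl
  map_smul' c f := by
    simp only [map_smul, RingHom.id_apply, smul_comm _ c]
    rfl

theorem graphMap_injective : Function.Injective (graphMap a b d) := fun f g h => by
  apply toL2_injective
  exact congrArg (fun x => x.fst) h

instance : NormedAddCommGroup (SobolevSpace a b d) :=
  NormedAddCommGroup.induced _ _ (graphMap a b d) (graphMap_injective a b d)

instance : NormedSpace ℂ (SobolevSpace a b d) :=
  NormedSpace.induced ℂ _ _ (graphMap a b d)

theorem norm_sq_eq_graph (f : SobolevSpace a b d) :
    ‖f‖ ^ 2 = ‖toL2 a b d f‖ ^ 2 + ∑ j : Fin d,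
      ‖((√(a (j + 1)) / (2 * Real.pi) ^ b (j + 1) : ℝ) : ℂ) • weylDeriv a b d j f‖ ^ 2 := by
  change ‖graphMap a b d f‖ ^ 2 = _
  rw [WithLp.prod_norm_sq_eq_of_L2, PiLp.norm_sq_eq_of_L2]
  rfl

/-- The norm of `W_2^{a,b}` is `(‖f‖₂² + ∑_j a_j (2π)^{-2b_j} ‖D_j^{b_j} f‖₂²)^{1/2}`. -/
theorem norm_eq (ha : ∀ j, 1 ≤ j → 0 < a j) (f : SobolevSpace a b d) :
    ‖f‖ = √(‖toL2 a b d f‖ ^ 2 + ∑ j : Fin d,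
      a (j + 1) / (2 * Real.pi) ^ (2 * b (j + 1)) * ‖weylDeriv a b d j f‖ ^ 2) := by
  rw [← Real.sqrt_sq (norm_nonneg f), norm_sq_eq_graph]
  congr 2
  refine Finset.sum_congr rfl fun j _ => ?_
  have hπ : (0 : ℝ) < 2 * Real.pi := by positivity
  rw [norm_smul, mul_pow, Complex.norm_real, Real.norm_eq_abs, sq_abs, div_pow,
    Real.sq_sqrt (ha _ (Nat.le_add_left 1 _)).le, mul_comm 2 (b (j + 1)), Real.rpow_mul hπ.le,
    Real.rpow_two]

theorem norm_toL2_le (f : SobolevSpace a b d) : ‖toL2 a b d f‖ ≤ ‖f‖ := by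
  refine (sq_le_sq₀ (norm_nonneg _) (norm_nonneg f)).mp ?_
  rw [norm_sq_eq_graph]
  exact le_add_of_nonneg_right (Finset.sum_nonneg fun _ _ => sq_nonneg _)

end SobolevSpace

/-- The embedding `I_d : W_2^{a,b}([0,1]^d) → L₂([0,1]^d)`, `I_d f = f`. -/
def sobolevEmbedding (a b : ℕ → ℝ) (d : ℕ) : SobolevSpace a b d →L[ℂ] L2Torus d :=
  (SobolevSpace.toL2 a b d).mkContinuous 1 fun f => by
    rw [one_mul]
    exact SobolevSpace.norm_toL2_le a b d f

/-! ### Information complexity -/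

section Complexity

variable {H G : Type*} [NormedAddCommGroup H] [NormedSpace ℂ H]
  [NormedAddCommGroup G] [NormedSpace ℂ G]

/-- `A f = φ (L₁ f, …, Lₙ f)` with continuous linear functionals `Lᵢ` and an arbitrary map `φ`;
for `n = 0` only the zero algorithm is used. -/
def IsAlgorithm (n : ℕ) (A : H → G) : Prop :=
  (∃ (L : Fin n → H →L[ℂ] ℂ) (φ : (Fin n → ℂ) → G), ∀ f, A f = φ fun i => L i f) ∧
    (n = 0 → A = 0)

/-- The worst case error of `A` over the unit ball of `H`. -/
def worstCaseError (S : H →L[ℂ] G) (A : H → G) : ℝ≥0∞ :=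
  ⨆ (f : H) (_ : ‖f‖ ≤ 1), ‖S f - A f‖ₑ

/-- The `n`-th minimal worst case error `e(n, S)`. -/
def minimalError (S : H →L[ℂ] G) (n : ℕ) : ℝ≥0∞ :=
  ⨅ (A : H → G) (_ : IsAlgorithm n A), worstCaseError S A

/-- The information complexity `n(ε, S) = min {n : e(n, S) ≤ ε}`. -/
def infoComplexity (S : H →L[ℂ] G) (ε : ℝ) : ℕ :=
  sInf {n : ℕ | minimalError S n ≤ ENNReal.ofReal ε}

end Complexity

/-! ### Notions of tractability of a problem `S = {S_d}_{d ≥ 1}` -/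

/-- `ε⁻¹ + d → ∞`, where `ε ∈ (0,1)` and `d = 1, 2, …`. -/
def tractabilityFilter : Filter (ℝ × ℕ) :=
  comap (fun p => p.1⁻¹ + (p.2 : ℝ)) atTop ⊓ 𝓟 (Set.Ioo 0 1 ×ˢ Set.Ici 1)

section Tractability

variable {H G : ℕ → Type*} [∀ d, NormedAddCommGroup (H d)] [∀ d, NormedSpace ℂ (H d)]
  [∀ d, NormedAddCommGroup (G d)] [∀ d, NormedSpace ℂ (G d)]

/-- Strong polynomial tractability. -/
def SPT (S : ∀ d, H d →L[ℂ] G d) : Prop :=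
  ∃ C p : ℝ, 0 ≤ C ∧ 0 ≤ p ∧ ∀ d : ℕ, 1 ≤ d → ∀ ε ∈ Set.Ioo (0 : ℝ) 1,
    (infoComplexity (S d) ε : ℝ) ≤ C * ε⁻¹ ^ p

/-- Polynomial tractability. -/
def PT (S : ∀ d, H d →L[ℂ] G d) : Prop :=
  ∃ C p q : ℝ, 0 ≤ C ∧ 0 ≤ p ∧ 0 ≤ q ∧ ∀ d : ℕ, 1 ≤ d → ∀ ε ∈ Set.Ioo (0 : ℝ) 1,
    (infoComplexity (S d) ε : ℝ) ≤ C * (d : ℝ) ^ q * ε⁻¹ ^ p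

/-- Quasi-polynomial tractability. -/
def QPT (S : ∀ d, H d →L[ℂ] G d) : Prop :=
  ∃ C t : ℝ, 0 < C ∧ 0 < t ∧ ∀ d : ℕ, 1 ≤ d → ∀ ε ∈ Set.Ioo (0 : ℝ) 1,
    (infoComplexity (S d) ε : ℝ) ≤
      C * Real.exp (t * (1 + Real.log ε⁻¹) * (1 + Real.log d))

/-- `(s,t)`-weak tractability. -/
def STWT (s t : ℝ) (S : ∀ d, H d →L[ℂ] G d) : Prop :=
  Tendsto (fun p : ℝ × ℕ =>
      Real.log (infoComplexity (S p.2) p.1) / (p.1⁻¹ ^ s + (p.2 : ℝ) ^ t))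
    tractabilityFilter (𝓝 0)

/-- Uniform weak tractability. -/
def UWT (S : ∀ d, H d →L[ℂ] G d) : Prop :=
  ∀ α β : ℝ, 0 < α → 0 < β →
    Tendsto (fun p : ℝ × ℕ =>
        Real.log (infoComplexity (S p.2) p.1) / (p.1⁻¹ ^ α + (p.2 : ℝ) ^ β))
      tractabilityFilter (𝓝 0)

/-- Weak tractability. -/
def WT (S : ∀ d, H d →L[ℂ] G d) : Prop :=
  Tendsto (fun p : ℝ × ℕ =>
      Real.log (infoComplexity (S p.2) p.1) / (p.1⁻¹ + (p.2 : ℝ)))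
    tractabilityFilter (𝓝 0)

end Tractability

end

end SobolevTractability

open SobolevTractability

/-! ### Fourier diagonalisation of the Sobolev norm -/

namespace SobolevTractability

/-! The Fourier characters are orthogonal in both spaces, and the squared Sobolev norm is `∑ₖ (1 +
freqCost k) |f̂(k)|²`. The embedding is therefore diagonal with singular values `(1 + freqCost
k)^(-1/2)`. Spectral truncation is optimal: an upper bound comes from keeping the frequencies with
singular value above `ε`, and a lower bound from a dimension count plus the symmetry `f ↦ -f`. So
`n(ε,d)` is the number of `k ∈ ℤ^d` with `∑ a_j |k_j|^(2 b_j) < ε⁻² - 1`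
(`infoComplexity_sobolevEmbedding`), and every claim becomes lattice point counting.

For the weak notions the upper bound is of Chernoff type (`log_infoComplexity_le`): for every `l ≥
0`, `ln n(ε,d) ≤ l ε⁻² + ∑_j ln ∑_m exp(-l a_j |m|^(2 b_j))`. Because `inf b_j > 0`, the
one-dimensional sums are controlled by `l a_j` alone, both by `exp(C (l a_j)^(-p))` for any `p > 0`
and, when `l a_j ≥ 1`, by `exp(C exp(-l a_j / 2))`. Each criterion follows from a suitable choice of
`l` and `p`. The converses count 0-1 vectors: all `2^d` of them cost at most `d a_d`, and those with
`m` ones cost at most `m a_d`, since `a` is monotone.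

For the polynomial notions the frequencies are enclosed in a box. Coordinates with `a_j ≥ ε⁻²` are
frozen at zero; the others contribute a constant each, plus `ln ε⁻¹` times `∑ 1/b_j`. Conversely,
for fixed `d` and `ε → 0` an inscribed box forces the exponent of `ε⁻¹` to be at least `∑ 1/b_j`,
and the `2^d` vectors at `ε⁻² = 1 + 2 d a_d` force the growth of `ln a_d`. -/

/-- The Fourier characters as a Hilbert basis of `L₂([0,1]^d)`. -/
noncomputable def fourierBasis (d : ℕ) : HilbertBasis (Fin d → ℤ) ℂ (L2Torus d) :=
  UnitAddTorus.mFourierBasis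

theorem fourierCoeffL2_eq_inner {d : ℕ} (f : L2Torus d) (k : Fin d → ℤ) :
    fourierCoeffL2 f k = inner ℂ (fourierBasis d k) f := by
  rw [fourierCoeffL2_eq_repr, ← HilbertBasis.repr_apply_apply]
  rfl

theorem hasSum_norm_sq_fourierCoeffL2 {d : ℕ} (f : L2Torus d) :
    HasSum (fun k => ‖fourierCoeffL2 f k‖ ^ 2) (‖f‖ ^ 2) := by
  have h := lp.hasSum_norm (p := 2) (by norm_num) ((fourierBasis d).repr f)
  rw [LinearIsometryEquiv.norm_map] at h
  simpa [HilbertBasis.repr_apply_apply, fourierCoeffL2_eq_inner] using h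

theorem fourierCoeffL2_basis {d : ℕ} (m k : Fin d → ℤ) :
    fourierCoeffL2 (fourierBasis d m) k = if k = m then 1 else 0 := by
  rw [fourierCoeffL2_eq_inner]
  exact orthonormal_iff_ite.mp (fourierBasis d).orthonormal k m

theorem fourierCoeffL2_sum {d : ℕ} {ι : Type*} (s : Finset ι) (f : ι → L2Torus d)
    (k : Fin d → ℤ) :
    fourierCoeffL2 (∑ i ∈ s, f i) k = ∑ i ∈ s, fourierCoeffL2 (f i) k := by
  simp only [fourierCoeffL2_eq_inner, inner_sum]

theorem fourierCoeffL2_sum_basis {d : ℕ} (s : Finset (Fin d → ℤ)) (c : (Fin d → ℤ) → ℂ)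
    (k : Fin d → ℤ) :
    fourierCoeffL2 (∑ m ∈ s, c m • fourierBasis d m) k = if k ∈ s then c k else 0 := by
  simp [fourierCoeffL2_sum, fourierCoeffL2_smul, fourierCoeffL2_basis]

theorem norm_weylSymbol (r : ℝ) (m : ℤ) : ‖weylSymbol r m‖ = |2 * Real.pi * (m : ℝ)| ^ r := by
  have h : (r : ℂ) * Real.pi * Complex.I / 2 * (m.sign : ℂ)
      = ((r * Real.pi / 2 * (m.sign : ℝ) : ℝ) : ℂ) * Complex.I := by
    push_cast
    ring
  rw [weylSymbol, norm_mul, h, Complex.norm_exp_ofReal_mul_I, mul_one, Complex.norm_real,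
    Real.norm_eq_abs, abs_of_nonneg (by positivity)]

/-- The quantity `∑_j a_j |k_j|^{2 b_j}`: the trigonometric monomial with frequency `k` has
squared Sobolev norm `1 + freqCost a b d k`. -/
noncomputable def freqCost (a b : ℕ → ℝ) (d : ℕ) (k : Fin d → ℤ) : ℝ :=
  ∑ j : Fin d, a (j + 1) * |(k j : ℝ)| ^ (2 * b (j + 1))

/-- Frequencies of cost less than `x`. -/
noncomputable def freqSet (a b : ℕ → ℝ) (d : ℕ) (x : ℝ) : Set (Fin d → ℤ) :=
  {k | freqCost a b d k < x}

theorem freqCost_term_nonneg {a b : ℕ → ℝ} (ha : ∀ j, 1 ≤ j → 0 < a j) {d : ℕ}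
    (k : Fin d → ℤ) (j : Fin d) : 0 ≤ a (j + 1) * |(k j : ℝ)| ^ (2 * b (j + 1)) :=
  mul_nonneg (ha _ (Nat.le_add_left 1 _)).le (by positivity)

theorem freqCost_nonneg {a b : ℕ → ℝ} (ha : ∀ j, 1 ≤ j → 0 < a j) {d : ℕ}
    (k : Fin d → ℤ) : 0 ≤ freqCost a b d k :=
  Finset.sum_nonneg fun j _ => freqCost_term_nonneg ha k j

theorem freqCost_zero {a b : ℕ → ℝ} (hb : ∀ j, 1 ≤ j → 0 < b j) {d : ℕ} :
    freqCost a b d 0 = 0 := by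
  refine Finset.sum_eq_zero fun j _ => ?_
  have := hb (j + 1) (Nat.le_add_left 1 _)
  simp [Real.zero_rpow (by positivity : 2 * b (j + 1) ≠ 0)]

theorem term_lt_of_mem_freqSet {a b : ℕ → ℝ} (ha : ∀ j, 1 ≤ j → 0 < a j) {d : ℕ} {x : ℝ}
    {k : Fin d → ℤ} (hk : k ∈ freqSet a b d x) (j : Fin d) :
    a (j + 1) * |(k j : ℝ)| ^ (2 * b (j + 1)) < x :=
  (Finset.single_le_sum (f := fun j : Fin d => a (j + 1) * |(k j : ℝ)| ^ (2 * b (j + 1)))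
    (fun j _ => freqCost_term_nonneg ha k j) (Finset.mem_univ j)).trans_lt hk

theorem abs_lt_of_mul_rpow_lt {α r x t : ℝ} (hα : 0 < α) (hr : 0 < r) (ht : 0 ≤ t)
    (h : α * t ^ r < x) : t < (x / α) ^ r⁻¹ := by
  rw [Real.lt_rpow_inv_iff_of_pos ht _ hr, lt_div_iff₀ hα, mul_comm]
  · exact h
  · have : 0 ≤ t ^ r := by positivity
    have : 0 < x := (by positivity : 0 ≤ α * t ^ r).trans_lt h
    positivity

theorem finite_freqSet {a b : ℕ → ℝ} (ha : ∀ j, 1 ≤ j → 0 < a j) (hb : ∀ j, 1 ≤ j → 0 < b j)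
    (d : ℕ) (x : ℝ) : (freqSet a b d x).Finite := by
  refine (Set.Finite.pi' (t := fun j : Fin d =>
    Set.Icc (-⌈(x / a (j + 1)) ^ (2 * b (j + 1))⁻¹⌉) ⌈(x / a (j + 1)) ^ (2 * b (j + 1))⁻¹⌉)
    fun j => Set.finite_Icc _ _).subset fun k hk j => ?_
  have h1 := ha (j + 1) (Nat.le_add_left 1 _)
  have h2 := hb (j + 1) (Nat.le_add_left 1 _)
  have h := abs_lt_of_mul_rpow_lt h1 (by positivity) (abs_nonneg _)
    (term_lt_of_mem_freqSet ha hk j)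
  have h' : |k j| ≤ ⌈(x / a (j + 1)) ^ (2 * b (j + 1))⁻¹⌉ := by
    have := h.le.trans (Int.le_ceil _)
    exact_mod_cast this
  exact abs_le.mp h'

namespace SobolevSpace

variable {a b : ℕ → ℝ} {d : ℕ}

/-- Parseval for `f` and for each derivative; the factor `(2π)^(-b_j)` in the norm cancels the `2π`
in the Weyl symbol, leaving `a_j |k_j|^(2 b_j)`. -/
theorem hasSum_norm_sq (ha : ∀ j, 1 ≤ j → 0 < a j) (f : SobolevSpace a b d) :
    HasSum (fun k => (1 + freqCost a b d k) * ‖fourierCoeffL2 (toL2 a b d f) k‖ ^ 2)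
      (‖f‖ ^ 2) := by
  rw [norm_sq_eq_graph]
  have h : ∀ j : Fin d, HasSum (fun k : Fin d → ℤ =>
      a (j + 1) * |(k j : ℝ)| ^ (2 * b (j + 1)) * ‖fourierCoeffL2 (toL2 a b d f) k‖ ^ 2)
      (‖((√(a (j + 1)) / (2 * Real.pi) ^ b (j + 1) : ℝ) : ℂ) • weylDeriv a b d j f‖ ^ 2) := by
    intro j
    convert hasSum_norm_sq_fourierCoeffL2 _ using 2 with k
    have hπ : (0 : ℝ) < 2 * Real.pi := by positivity
    rw [fourierCoeffL2_smul, isWeylDeriv_weylDeriv a b d j f k, norm_mul, norm_mul,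
      norm_weylSymbol, Complex.norm_real, Real.norm_eq_abs, abs_mul, abs_of_pos hπ,
      Real.mul_rpow hπ.le (abs_nonneg _), mul_pow, mul_pow, mul_pow, sq_abs, div_pow,
      Real.sq_sqrt (ha _ (Nat.le_add_left 1 _)).le, mul_comm 2 (b _),
      Real.rpow_mul (abs_nonneg _), Real.rpow_two]
    field_simp
  convert (hasSum_norm_sq_fourierCoeffL2 (toL2 a b d f)).add (hasSum_sum fun j _ => h j) using 2
    with k
  rw [freqCost, add_mul, one_mul, Finset.sum_mul]

theorem fourierBasis_mem (b : ℕ → ℝ) (k : Fin d → ℤ) :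
    fourierBasis d k ∈ sobolevSubmodule b d := fun j =>
  ⟨weylSymbol (b (j + 1)) (k j) • fourierBasis d k, fun m => by
    rw [fourierCoeffL2_smul, fourierCoeffL2_basis]
    split_ifs with h
    · rw [h]
    · simp⟩

/-- The Fourier character with frequency `k`, as an element of the Sobolev space. -/
noncomputable def character (a b : ℕ → ℝ) (k : Fin d → ℤ) : SobolevSpace a b d :=
  (⟨fourierBasis d k, fourierBasis_mem b k⟩ : sobolevSubmodule b d)

theorem toL2_character (k : Fin d → ℤ) :
    toL2 a b d (character a b k) = fourierBasis d k := rfl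

/-- The `k`-th Fourier coefficient, as a continuous functional on the Sobolev space. -/
noncomputable def coeffFunctional (a b : ℕ → ℝ) (k : Fin d → ℤ) : SobolevSpace a b d →L[ℂ] ℂ :=
  (innerSL ℂ (fourierBasis d k)).comp (sobolevEmbedding a b d)

theorem coeffFunctional_apply (k : Fin d → ℤ) (f : SobolevSpace a b d) :
    coeffFunctional a b k f = fourierCoeffL2 (toL2 a b d f) k :=
  (fourierCoeffL2_eq_inner _ _).symm

end SobolevSpace

/-! ### Information complexity as a count of frequencies -/

open SobolevSpace

/-- Truncation of the Fourier series to `freqSet` does it: every discarded coefficient has weight `1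
+ freqCost k ≥ ε⁻²`, so the tail is at most `ε² ‖f‖²`. -/
theorem minimalError_ncard_freqSet_le {a b : ℕ → ℝ} (ha : ∀ j, 1 ≤ j → 0 < a j)
    (hb : ∀ j, 1 ≤ j → 0 < b j) (d : ℕ) {ε : ℝ} (hε : ε ∈ Set.Ioo (0 : ℝ) 1) :
    minimalError (sobolevEmbedding a b d) (freqSet a b d (ε⁻¹ ^ 2 - 1)).ncard ≤
      ENNReal.ofReal ε := by
  obtain ⟨h0, h1⟩ := hε
  set S := (finite_freqSet ha hb d (ε⁻¹ ^ 2 - 1)).toFinset with hS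
  have hmem : ∀ k, k ∈ S ↔ freqCost a b d k < ε⁻¹ ^ 2 - 1 := fun k => by simp [hS, freqSet]
  have hcard : (freqSet a b d (ε⁻¹ ^ 2 - 1)).ncard = S.card :=
    Set.ncard_eq_toFinset_card _ (finite_freqSet ha hb d (ε⁻¹ ^ 2 - 1))
  have hinv : 1 < ε⁻¹ ^ 2 := one_lt_pow₀ ((one_lt_inv₀ h0).mpr h1) two_ne_zero
  -- The zero frequency is always kept, so the clause forcing `A = 0` when `n = 0` never applies.
  have hne : S.card ≠ 0 := Finset.card_ne_zero.mpr
    ⟨0, (hmem 0).mpr (by rw [freqCost_zero hb]; linarith)⟩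
  rw [hcard]
  let A : SobolevSpace a b d → L2Torus d := fun f =>
    ∑ k ∈ S, fourierCoeffL2 (toL2 a b d f) k • fourierBasis d k
  refine (iInf₂_le A ⟨⟨fun i => coeffFunctional a b (S.equivFin.symm i).1,
    fun v => ∑ i, v i • fourierBasis d (S.equivFin.symm i).1, fun f => ?_⟩,
    fun h => absurd h hne⟩).trans ?_
  rotate_left
  · simp only [coeffFunctional_apply, A]
    rw [Equiv.sum_comp S.equivFin.symm (fun k : S =>
      fourierCoeffL2 (toL2 a b d f) k.1 • fourierBasis d k.1)]
    exact (Finset.sum_coe_sort S (fun k =>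
      fourierCoeffL2 (toL2 a b d f) k • fourierBasis d k)).symm
  · refine iSup₂_le fun f hf => ?_
    rw [← ofReal_norm]
    refine ENNReal.ofReal_le_ofReal (abs_le_of_sq_le_sq' ?_ h0.le).2
    have hsum := (hasSum_norm_sq ha f).mul_left (ε ^ 2)
    refine (hasSum_le (fun k => ?_) (hasSum_norm_sq_fourierCoeffL2 _) hsum).trans ?_
    · have hsub : fourierCoeffL2 (sobolevEmbedding a b d f - A f) k =
          if k ∈ S then 0 else fourierCoeffL2 (toL2 a b d f) k := by
        have : fourierCoeffL2 (A f) k = _ :=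
          fourierCoeffL2_sum_basis S (fourierCoeffL2 (toL2 a b d f)) k
        rw [fourierCoeffL2_eq_inner, inner_sub_right, ← fourierCoeffL2_eq_inner,
          ← fourierCoeffL2_eq_inner, this]
        change fourierCoeffL2 (toL2 a b d f) k - _ = _
        split_ifs <;> simp
      rw [hsub]
      have := freqCost_nonneg (b := b) ha k
      split_ifs with hk
      · rw [norm_zero, zero_pow two_ne_zero]
        positivity
      · rw [hmem, not_lt, sub_le_iff_le_add, inv_pow, inv_le_iff_one_le_mul₀ (by positivity)] at hk
        nlinarith [sq_nonneg ‖fourierCoeffL2 (toL2 a b d f) k‖]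
    · have : ‖f‖ ^ 2 ≤ 1 := pow_le_one₀ (norm_nonneg f) hf
      nlinarith [sq_nonneg ε]

/-- With fewer functionals than frequencies, some unit vector `f` with spectrum in `S` is
annihilated by all of them. The algorithm returns `φ 0` on both `f` and `-f`, so one of the two
errors is at least `‖f‖₂`, which is large because every cost in `S` is small. -/
theorem ncard_freqSet_le_of_minimalError_le {a b : ℕ → ℝ} (ha : ∀ j, 1 ≤ j → 0 < a j)
    (hb : ∀ j, 1 ≤ j → 0 < b j) (d : ℕ) {ε : ℝ} (hε : ε ∈ Set.Ioo (0 : ℝ) 1) {n : ℕ}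
    (hn : minimalError (sobolevEmbedding a b d) n ≤ ENNReal.ofReal ε) :
    (freqSet a b d (ε⁻¹ ^ 2 - 1)).ncard ≤ n := by
  obtain ⟨h0, h1⟩ := hε
  set S := (finite_freqSet ha hb d (ε⁻¹ ^ 2 - 1)).toFinset with hS
  have hmem : ∀ k, k ∈ S ↔ freqCost a b d k < ε⁻¹ ^ 2 - 1 := fun k => by simp [hS, freqSet]
  have hcard : (freqSet a b d (ε⁻¹ ^ 2 - 1)).ncard = S.card :=
    Set.ncard_eq_toFinset_card _ (finite_freqSet ha hb d (ε⁻¹ ^ 2 - 1))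
  rw [hcard]
  by_contra! hlt
  have hSne : S.Nonempty := Finset.card_pos.mp (n.zero_le.trans_lt hlt)
  -- The largest cost in the finite set `S` gives a lower bound `Ω^(-1/2)` strictly above `ε` and
  -- independent of the algorithm, so it survives the infimum, attained or not.
  obtain ⟨k₀, hk₀, hmax⟩ := S.exists_max_image (freqCost a b d) hSne
  set Ω := 1 + freqCost a b d k₀ with hΩ
  have hΩ1 : 1 ≤ Ω := by linarith [freqCost_nonneg (b := b) ha k₀]
  have hΩε : Ω < ε⁻¹ ^ 2 := by linarith [(hmem k₀).mp hk₀]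
  have hlow : ε < √(Ω⁻¹) := by
    rw [Real.lt_sqrt h0.le, lt_inv_comm₀ (by positivity) (by positivity), ← inv_pow]
    exact hΩε
  refine absurd hn (not_le.mpr (((ENNReal.ofReal_lt_ofReal_iff (by positivity)).mpr
    hlow).trans_le ?_))
  refine le_iInf₂ fun A hA => ?_
  obtain ⟨⟨L, φ, hLφ⟩, -⟩ := hA
  let T : (S → ℂ) →ₗ[ℂ] SobolevSpace a b d :=
    ∑ k : S, (LinearMap.toSpanSingleton ℂ _ (character a b k.1)).comp (LinearMap.proj k)
  have hT : ∀ c, T c = ∑ k : S, c k • character a b k.1 := fun c => by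
    simp [T]
  let Λ : SobolevSpace a b d →ₗ[ℂ] (Fin n → ℂ) := LinearMap.pi fun i => (L i : _ →ₗ[ℂ] ℂ)
  have hker : (Λ.comp T).ker ≠ ⊥ := LinearMap.ker_ne_bot_of_finrank_lt (by simpa using hlt)
  obtain ⟨c, hc, hc0⟩ := (Submodule.ne_bot_iff _).mp hker
  have hcoeff : ∀ k, fourierCoeffL2 (toL2 a b d (T c)) k =
      if h : k ∈ S then c ⟨k, h⟩ else 0 := fun k => by
    rw [hT, map_sum, fourierCoeffL2_sum]
    simp only [map_smul, toL2_character, fourierCoeffL2_smul, fourierCoeffL2_basis, mul_ite,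
      mul_one, mul_zero]
    split_ifs with h
    · rw [Finset.sum_eq_single ⟨k, h⟩]
      · simp
      · rintro m - hm
        rw [if_neg]
        rintro rfl
        exact hm rfl
      · simp
    · refine Finset.sum_eq_zero fun m _ => if_neg ?_
      rintro rfl
      exact h m.2
  have hT0 : T c ≠ 0 := fun h => hc0 (funext fun k => by
    have := hcoeff k.1
    rw [h, map_zero, dif_pos k.2] at this
    rw [Pi.zero_apply, ← this, fourierCoeffL2_eq_inner, inner_zero_right])
  have hnorm : 0 < ‖T c‖ := norm_pos_iff.mpr hT0
  set f := ((‖T c‖⁻¹ : ℝ) : ℂ) • T c with hf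
  have hf1 : ‖f‖ = 1 := by
    rw [hf, norm_smul, Complex.norm_real, Real.norm_eq_abs, abs_of_pos (by positivity)]
    field_simp
  have hLf : ∀ i, L i f = 0 := fun i => by
    have : L i (T c) = 0 := congrFun (LinearMap.mem_ker.mp hc) i
    rw [hf, map_smul, this, smul_zero]
  have hΩf : Ω⁻¹ ≤ ‖toL2 a b d f‖ ^ 2 := by
    rw [inv_le_iff_one_le_mul₀ (by positivity), mul_comm]
    calc (1 : ℝ) = ‖f‖ ^ 2 := by rw [hf1, one_pow]
      _ ≤ _ := hasSum_le (fun k => ?_) (hasSum_norm_sq ha f)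
        ((hasSum_norm_sq_fourierCoeffL2 _).mul_left Ω)
    by_cases hk : k ∈ S
    · exact mul_le_mul_of_nonneg_right (by linarith [hmax k hk]) (sq_nonneg _)
    · simp [hf, fourierCoeffL2_smul, hcoeff, hk]
  have hlow2 : √(Ω⁻¹) ≤ ‖toL2 a b d f‖ := Real.sqrt_le_iff.mpr ⟨norm_nonneg _, hΩf⟩
  have hA1 : A f = φ 0 := by
    rw [hLφ]
    congr 1
    exact funext hLf
  have hA2 : A (-f) = φ 0 := by
    rw [hLφ]
    congr 1
    exact funext fun i => by rw [map_neg, hLf, neg_zero]; rfl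
  have hle : ∀ g : SobolevSpace a b d, ‖g‖ ≤ 1 →
      ENNReal.ofReal ‖toL2 a b d g - A g‖ ≤ worstCaseError (sobolevEmbedding a b d) A :=
    fun g hg => by
      rw [ofReal_norm]
      exact le_iSup₂ (f := fun (f : SobolevSpace a b d) (_ : ‖f‖ ≤ 1) =>
        ‖sobolevEmbedding a b d f - A f‖ₑ) g hg
  have hu := hle f hf1.le
  have hv := hle (-f) (by rw [norm_neg, hf1])
  rw [hA1] at hu
  rw [hA2, map_neg] at hv
  have htri : 2 * ‖toL2 a b d f‖ ≤ ‖toL2 a b d f - φ 0‖ + ‖-toL2 a b d f - φ 0‖ := by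
    have := norm_sub_le (toL2 a b d f - φ 0) (-toL2 a b d f - φ 0)
    rwa [sub_sub_sub_cancel_right, sub_neg_eq_add, ← two_smul ℝ (toL2 a b d f), norm_smul,
      Real.norm_ofNat] at this
  rcases le_total ‖toL2 a b d f‖ ‖toL2 a b d f - φ 0‖ with h | h
  · exact (ENNReal.ofReal_le_ofReal (hlow2.trans h)).trans hu
  · exact (ENNReal.ofReal_le_ofReal (hlow2.trans (by linarith))).trans hv

/-- The information complexity counts the frequencies of cost less than `ε⁻² - 1`. -/
theorem infoComplexity_sobolevEmbedding {a b : ℕ → ℝ} (ha : ∀ j, 1 ≤ j → 0 < a j)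
    (hb : ∀ j, 1 ≤ j → 0 < b j) (d : ℕ) {ε : ℝ} (hε : ε ∈ Set.Ioo (0 : ℝ) 1) :
    infoComplexity (sobolevEmbedding a b d) ε = (freqSet a b d (ε⁻¹ ^ 2 - 1)).ncard :=
  le_antisymm (Nat.sInf_le (minimalError_ncard_freqSet_le ha hb d hε))
    (le_csInf ⟨_, minimalError_ncard_freqSet_le ha hb d hε⟩ fun _ hn =>
      ncard_freqSet_le_of_minimalError_le ha hb d hε hn)

/-! ### Upper and lower bounds for the number of frequencies -/

section Counting

variable {a b : ℕ → ℝ}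

theorem card_le_ncard_freqSet (ha : ∀ j, 1 ≤ j → 0 < a j) (hb : ∀ j, 1 ≤ j → 0 < b j)
    {d : ℕ} {x : ℝ} (F : Finset (Fin d → ℤ)) (hF : ∀ k ∈ F, freqCost a b d k < x) :
    F.card ≤ (freqSet a b d x).ncard := by
  rw [← Set.ncard_coe_finset]
  exact Set.ncard_le_ncard hF (finite_freqSet ha hb d x)

theorem one_le_ncard_freqSet (ha : ∀ j, 1 ≤ j → 0 < a j) (hb : ∀ j, 1 ≤ j → 0 < b j)
    {d : ℕ} {x : ℝ} (hx : 0 < x) : 1 ≤ (freqSet a b d x).ncard := by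
  simpa using card_le_ncard_freqSet ha hb {(0 : Fin d → ℤ)} (by simp [freqCost_zero hb, hx])

theorem freqCost_indicator_le (ha_mono : MonotoneOn a (Set.Ici 1))
    (hb : ∀ j, 1 ≤ j → 0 < b j) {d : ℕ} (s : Finset (Fin d)) :
    freqCost a b d (fun j => if j ∈ s then 1 else 0) ≤ s.card * a d := by
  have h : freqCost a b d (fun j => if j ∈ s then 1 else 0) = ∑ j ∈ s, a (j + 1) := by
    rw [freqCost, ← Finset.sum_subset (Finset.subset_univ s)]
    · exact Finset.sum_congr rfl fun j hj => by simp [hj]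
    · intro j _ hj
      have := hb (j + 1) (Nat.le_add_left 1 _)
      simp [hj, Real.zero_rpow (by positivity : 2 * b (j + 1) ≠ 0)]
  rw [h, ← nsmul_eq_mul]
  refine Finset.sum_le_card_nsmul _ _ _ fun j _ => ?_
  have h1 : (j : ℕ) + 1 ≤ d := j.2
  exact ha_mono (Set.mem_Ici.mpr (Nat.le_add_left 1 _))
    (Set.mem_Ici.mpr ((Nat.le_add_left 1 _).trans h1)) h1

theorem indicator_injective (d : ℕ) :
    Function.Injective (fun (s : Finset (Fin d)) (j : Fin d) => if j ∈ s then (1 : ℤ) else 0) := by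
  intro s t h
  ext j
  have := congrFun h j
  by_cases hs : j ∈ s <;> by_cases ht : j ∈ t <;> simp_all

/-- Indicator vectors of `m`-element subsets are distinct frequencies, and monotonicity of `a`
bounds the price of each one by `a d`. -/
theorem choose_le_ncard_freqSet (ha : ∀ j, 1 ≤ j → 0 < a j) (ha_mono : MonotoneOn a (Set.Ici 1))
    (hb : ∀ j, 1 ≤ j → 0 < b j) {d m : ℕ} {x : ℝ} (hx : m * a d < x) :
    d.choose m ≤ (freqSet a b d x).ncard := by
  have h := card_le_ncard_freqSet ha hb (x := x)
    (((Finset.univ : Finset (Fin d)).powersetCard m).map ⟨_, indicator_injective d⟩) ?_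
  · simpa using h
  · simp only [Finset.mem_map, Finset.mem_powersetCard_univ, Function.Embedding.coeFn_mk]
    rintro _ ⟨s, rfl, rfl⟩
    exact (freqCost_indicator_le ha_mono hb s).trans_lt hx

theorem two_pow_le_ncard_freqSet (ha : ∀ j, 1 ≤ j → 0 < a j)
    (ha_mono : MonotoneOn a (Set.Ici 1)) (hb : ∀ j, 1 ≤ j → 0 < b j) {d : ℕ} (hd : 1 ≤ d)
    {x : ℝ} (hx : d * a d < x) : 2 ^ d ≤ (freqSet a b d x).ncard := by
  have h := card_le_ncard_freqSet ha hb (x := x)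
    ((Finset.univ : Finset (Finset (Fin d))).map ⟨_, indicator_injective d⟩) ?_
  · simpa using h
  · simp only [Finset.mem_map, Finset.mem_univ, true_and, Function.Embedding.coeFn_mk]
    rintro _ ⟨s, rfl⟩
    refine (freqCost_indicator_le ha_mono hb s).trans_lt (lt_of_le_of_lt ?_ hx)
    have : (s.card : ℝ) ≤ d := by exact_mod_cast card_finset_fin_le s
    exact mul_le_mul_of_nonneg_right this (ha d hd).le

/-- Split the budget evenly: a box in which each coordinate costs less than `x / d` lies inside the
set. -/
theorem prod_rpow_le_ncard_freqSet (ha : ∀ j, 1 ≤ j → 0 < a j) (hb : ∀ j, 1 ≤ j → 0 < b j)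
    {d : ℕ} (hd : 1 ≤ d) {x : ℝ} (hx : 0 < x) :
    ∏ j : Fin d, (x / (d * a (j + 1))) ^ (2 * b (j + 1))⁻¹ ≤ (freqSet a b d x).ncard := by
  set R : Fin d → ℝ := fun j => (x / (d * a (j + 1))) ^ (2 * b (j + 1))⁻¹ with hR
  have hd0 : (0 : ℝ) < d := by exact_mod_cast hd
  have h := card_le_ncard_freqSet ha hb (x := x)
    -- The naturals below `⌈R j⌉₊` are exactly those strictly below `R j`. This gives the strict
    -- cost bound and at least `R j` choices, even if `R j < 1`.
    (Fintype.piFinset fun j => (Finset.range ⌈R j⌉₊).map Nat.castEmbedding) ?_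
  · simp only [Fintype.card_piFinset, Finset.card_map, Finset.card_range] at h
    calc ∏ j, R j ≤ ∏ j, (⌈R j⌉₊ : ℝ) := Finset.prod_le_prod (fun j _ => by
          have := ha (j + 1) (Nat.le_add_left 1 _)
          positivity) fun j _ => Nat.le_ceil _
      _ ≤ _ := by exact_mod_cast h
  · intro k hk
    simp only [Fintype.mem_piFinset, Finset.mem_map, Finset.mem_range,
      Nat.castEmbedding_apply] at hk
    have : NeZero d := ⟨by omega⟩
    calc freqCost a b d k < ∑ _j : Fin d, x / d := Finset.sum_lt_sum_of_nonempty
          Finset.univ_nonempty fun j _ => ?_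
      _ = x := by simp; field_simp
    obtain ⟨n, hn, hnk⟩ := hk j
    have h1 := ha (j + 1) (Nat.le_add_left 1 _)
    have h2 := hb (j + 1) (Nat.le_add_left 1 _)
    have h3 : (n : ℝ) < R j := Nat.lt_ceil.mp hn
    rw [hR, Real.lt_rpow_inv_iff_of_pos (by positivity) (by positivity) (by positivity),
      lt_div_iff₀ (by positivity)] at h3
    rw [← hnk, Int.cast_natCast, abs_of_nonneg (Nat.cast_nonneg n), lt_div_iff₀ hd0]
    linarith

/-- If all coordinates of the frequencies range over given sets, these bound their number. -/
theorem ncard_freqSet_le_prod (ha : ∀ j, 1 ≤ j → 0 < a j) {d : ℕ} {x : ℝ}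
    (T : Fin d → Finset ℤ)
    (hT : ∀ (j : Fin d) (m : ℤ), a (j + 1) * |(m : ℝ)| ^ (2 * b (j + 1)) < x → m ∈ T j) :
    (freqSet a b d x).ncard ≤ ∏ j, (T j).card := by
  rw [← Fintype.card_piFinset, ← Set.ncard_coe_finset]
  refine Set.ncard_le_ncard (fun k hk => ?_) (Finset.finite_toSet _)
  simp only [Finset.mem_coe, Fintype.mem_piFinset]
  exact fun j => hT j _ (term_lt_of_mem_freqSet ha hk j)

/-- Each coordinate satisfies `|m| < R = (x / a_j)^(1/(2 b_j))`. If `R ≤ 1` only zero is left;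
otherwise there are at most `2⌊R⌋ + 1 ≤ 3R` values. -/
theorem log_ncard_freqSet_le_sum (ha : ∀ j, 1 ≤ j → 0 < a j) (hb : ∀ j, 1 ≤ j → 0 < b j)
    {d : ℕ} {x : ℝ} (hx : 0 < x) :
    Real.log (freqSet a b d x).ncard ≤ ∑ j : Fin d, if x ≤ a (j + 1) then 0 else
      Real.log 3 + (2 * b (j + 1))⁻¹ * Real.log (x / a (j + 1)) := by
  set R : Fin d → ℝ := fun j => (x / a (j + 1)) ^ (2 * b (j + 1))⁻¹ with hR
  have h := ncard_freqSet_le_prod (b := b) ha (d := d) (x := x)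
    (fun j => if x ≤ a (j + 1) then {0} else Finset.Icc (-⌊R j⌋) ⌊R j⌋) ?_
  · have hpos := one_le_ncard_freqSet ha hb (d := d) hx
    have h' : ((freqSet a b d x).ncard : ℝ) ≤ ∏ j : Fin d,
        Real.exp (if x ≤ a (j + 1) then 0 else
          Real.log 3 + (2 * b (j + 1))⁻¹ * Real.log (x / a (j + 1))) := by
      refine (Nat.cast_le.mpr h).trans ?_
      push_cast
      refine Finset.prod_le_prod (fun j _ => by positivity) fun j _ => ?_
      have h1 := ha (j + 1) (Nat.le_add_left 1 _)
      have h2 := hb (j + 1) (Nat.le_add_left 1 _)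
      split_ifs with hj
      · simp
      · have hR1 : 1 ≤ R j := Real.one_le_rpow
          ((one_le_div₀ h1).mpr (not_le.mp hj).le) (by positivity)
        have hfl : (0 : ℤ) ≤ ⌊R j⌋ := Int.floor_nonneg.mpr (by linarith)
        rw [Real.exp_add, Real.exp_log (by norm_num), mul_comm (_⁻¹), ← Real.rpow_def_of_pos
          (by positivity), Int.card_Icc]
        have h3 : (((⌊R j⌋ + 1 - -⌊R j⌋).toNat : ℕ) : ℝ) = 2 * ⌊R j⌋ + 1 := by
          have : ((⌊R j⌋ + 1 - -⌊R j⌋).toNat : ℤ) = 2 * ⌊R j⌋ + 1 := by omega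
          exact_mod_cast this
        rw [h3]
        have := Int.floor_le (R j)
        change _ ≤ 3 * R j
        linarith
    rw [← Real.exp_sum] at h'
    exact (Real.log_le_iff_le_exp (by exact_mod_cast hpos)).mpr h'
  · intro j m hm
    have h1 := ha (j + 1) (Nat.le_add_left 1 _)
    have h2 := hb (j + 1) (Nat.le_add_left 1 _)
    have h3 := abs_lt_of_mul_rpow_lt h1 (by positivity) (abs_nonneg _) hm
    split_ifs with hj
    · have : |(m : ℝ)| < 1 := h3.trans_le (Real.rpow_le_one (by positivity)
        ((div_le_one₀ h1).mpr hj) (by positivity))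
      rw [Finset.mem_singleton, ← Int.abs_lt_one_iff]
      exact_mod_cast this
    · rw [Finset.mem_Icc, ← abs_le]
      exact Int.le_floor.mpr (by exact_mod_cast h3.le)

/-- Chernoff-type bound for the number of frequencies. -/
theorem log_ncard_freqSet_le_of_forall_sum_exp_le (ha : ∀ j, 1 ≤ j → 0 < a j)
    (hb : ∀ j, 1 ≤ j → 0 < b j) {d : ℕ} {x l : ℝ} (hx : 0 < x) (hl : 0 ≤ l) (G : Fin d → ℝ)
    (hG : ∀ (j : Fin d) (T : Finset ℤ),
      ∑ m ∈ T, Real.exp (-(l * a (j + 1) * |(m : ℝ)| ^ (2 * b (j + 1)))) ≤ Real.exp (G j)) :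
    Real.log (freqSet a b d x).ncard ≤ l * x + ∑ j, G j := by
  have hpos := one_le_ncard_freqSet ha hb (d := d) hx
  rw [Real.log_le_iff_le_exp (by exact_mod_cast hpos), Real.exp_add, Real.exp_sum]
  set S := (finite_freqSet ha hb d x).toFinset with hS
  have hmem : ∀ k, k ∈ S ↔ freqCost a b d k < x := fun k => by simp [hS, freqSet]
  rw [Set.ncard_eq_toFinset_card _ (finite_freqSet ha hb d x)]
  -- Enlarging `S` to the product of its projections makes the exponential sum factor over
  -- coordinates while keeping all sums finite.
  let T : Fin d → Finset ℤ := fun j => S.image fun k => k j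
  calc (S.card : ℝ) = ∑ _k ∈ S, 1 := by simp
    _ ≤ ∑ k ∈ S, Real.exp (l * x) * Real.exp (-(l * freqCost a b d k)) := by
      refine Finset.sum_le_sum fun k hk => ?_
      rw [← Real.exp_add, Real.one_le_exp_iff]
      nlinarith [(hmem k).mp hk]
    _ = Real.exp (l * x) * ∑ k ∈ S, Real.exp (-(l * freqCost a b d k)) := by
      rw [Finset.mul_sum]
    _ ≤ Real.exp (l * x) * ∑ k ∈ Fintype.piFinset T, Real.exp (-(l * freqCost a b d k)) := by
      gcongr
      intro k hk
      exact Fintype.mem_piFinset.mpr fun j => Finset.mem_image_of_mem (fun k => k j) hk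
    _ = Real.exp (l * x) * ∏ j, ∑ m ∈ T j,
        Real.exp (-(l * a (j + 1) * |(m : ℝ)| ^ (2 * b (j + 1)))) := by
      rw [Finset.prod_univ_sum]
      congr 1
      refine Finset.sum_congr rfl fun k _ => ?_
      rw [← Real.exp_sum, freqCost, Finset.mul_sum, ← Finset.sum_neg_distrib]
      simp only [mul_assoc]
    _ ≤ _ := by
      gcongr with j
      exact hG j _

end Counting

/-! ### One-dimensional exponential sums -/

section ExpSum

theorem exp_neg_le_mul_rpow_neg {m : ℝ} (hm : 0 < m) :
    ∃ C : ℝ, 0 < C ∧ ∀ u : ℝ, 0 < u → Real.exp (-u) ≤ C * u ^ (-m) := by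
  refine ⟨m ^ m, by positivity, fun u hu => ?_⟩
  have h : u / m ≤ Real.exp (u / m) := by linarith [Real.add_one_le_exp (u / m)]
  have h2 : (u / m) ^ m ≤ Real.exp u := by
    calc (u / m) ^ m ≤ Real.exp (u / m) ^ m := by gcongr
      _ = Real.exp u := by rw [← Real.exp_mul, div_mul_cancel₀ _ hm.ne']
  rw [Real.exp_neg, Real.rpow_neg hu.le, ← div_eq_mul_inv]
  rw [Real.div_rpow hu.le hm.le, div_le_iff₀ (by positivity)] at h2
  rw [inv_le_iff_one_le_mul₀ (by positivity), div_mul_eq_mul_div, le_div_iff₀ (by positivity)]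
  linarith

/-- Replace the exponential by a power: `|k|^(-mβ)` is summable since `mβ > 1`. As `|k| ≥ 1`, an
exponent `r ≥ β` only helps, so the constant is uniform in `r`. -/
theorem sum_exp_erase_le {β m : ℝ} (hβ : 0 < β) (hm : 1 < m * β) :
    ∃ C : ℝ, 0 < C ∧ ∀ r, β ≤ r → ∀ y : ℝ, 0 < y → ∀ T : Finset ℤ,
      ∑ k ∈ T.erase 0, Real.exp (-(y * |(k : ℝ)| ^ r)) ≤ C * y ^ (-m) := by
  have hm0 : 0 < m := pos_of_mul_pos_left (by linarith) hβ.le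
  obtain ⟨C, hC, hexp⟩ := exp_neg_le_mul_rpow_neg hm0
  have hs := Real.summable_abs_int_rpow hm
  refine ⟨C * ((∑' k : ℤ, |(k : ℝ)| ^ (-(m * β))) + 1), ?_, fun r hr y hy T => ?_⟩
  · have : 0 ≤ ∑' k : ℤ, |(k : ℝ)| ^ (-(m * β)) := tsum_nonneg fun k => by positivity
    positivity
  · calc ∑ k ∈ T.erase 0, Real.exp (-(y * |(k : ℝ)| ^ r))
        ≤ ∑ k ∈ T.erase 0, C * y ^ (-m) * |(k : ℝ)| ^ (-(m * β)) := by
          refine Finset.sum_le_sum fun k hk => ?_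
          have hk0 : k ≠ 0 := (Finset.mem_erase.mp hk).1
          have hk1 : (1 : ℝ) ≤ |(k : ℝ)| := by exact_mod_cast Int.one_le_abs hk0
          have hkp : 0 < |(k : ℝ)| := by linarith
          calc Real.exp (-(y * |(k : ℝ)| ^ r)) ≤ Real.exp (-(y * |(k : ℝ)| ^ β)) := by
                gcongr
            _ ≤ C * (y * |(k : ℝ)| ^ β) ^ (-m) := hexp _ (by positivity)
            _ = _ := by
              rw [Real.mul_rpow hy.le (by positivity), ← Real.rpow_mul hkp.le, mul_assoc]
              ring_nf
      _ = C * y ^ (-m) * ∑ k ∈ T.erase 0, |(k : ℝ)| ^ (-(m * β)) := by rw [Finset.mul_sum]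
      _ ≤ C * y ^ (-m) * ((∑' k : ℤ, |(k : ℝ)| ^ (-(m * β))) + 1) := by
          gcongr
          have := hs.sum_le_tsum (T.erase 0) fun k _ => by positivity
          linarith
      _ = _ := by ring

theorem sum_exp_le_one_add {r y : ℝ} (hr : 0 < r) (T : Finset ℤ) :
    ∑ k ∈ T, Real.exp (-(y * |(k : ℝ)| ^ r)) ≤
      1 + ∑ k ∈ T.erase 0, Real.exp (-(y * |(k : ℝ)| ^ r)) := by
  by_cases h : (0 : ℤ) ∈ T
  · rw [← Finset.add_sum_erase T _ h]
    simp [Real.zero_rpow hr.ne']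
  · rw [Finset.erase_eq_of_notMem h]
    linarith

/-- Subadditivity of `t ↦ t^r` for `r ≤ 1` gives `(1 + z)^r ≤ 1 + z^r ≤ exp(z^r)`. -/
theorem one_add_le_exp_rpow {z r : ℝ} (hz : 0 ≤ z) (hr : 0 < r) (hr1 : r ≤ 1) :
    1 + z ≤ Real.exp (r⁻¹ * z ^ r) := by
  have h1 : (1 + z) ^ r ≤ Real.exp (z ^ r) := by
    have h := Real.rpow_add_le_add_rpow zero_le_one hz hr.le hr1
    rw [Real.one_rpow] at h
    linarith [Real.add_one_le_exp (z ^ r)]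
  calc 1 + z = ((1 + z) ^ r) ^ r⁻¹ := (Real.rpow_rpow_inv (by positivity) hr.ne').symm
    _ ≤ Real.exp (z ^ r) ^ r⁻¹ := by gcongr
    _ = _ := by rw [← Real.exp_mul, mul_comm]

/-- Sums of `exp (-y |k|^r)` grow more slowly than the exponential of any power of `1 / y`. -/
theorem sum_exp_le_exp_rpow {β p : ℝ} (hβ : 0 < β) (hp : 0 < p) :
    ∃ C : ℝ, 0 < C ∧ ∀ r, β ≤ r → ∀ y : ℝ, 0 < y → ∀ T : Finset ℤ,
      ∑ k ∈ T, Real.exp (-(y * |(k : ℝ)| ^ r)) ≤ Real.exp (C * y ^ (-p)) := by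
  -- Large enough for `mβ > 1` and for `p / m ≤ 1`; the latter lets `1 + C y^(-m)` be traded for an
  -- exponential of `y^(-p)`.
  set m := p + 2 / β with hm
  have hm0 : 0 < m := by positivity
  obtain ⟨C, hC, h⟩ := sum_exp_erase_le hβ (m := m) (by
    rw [hm, add_mul, div_mul_cancel₀ _ hβ.ne']
    nlinarith)
  have hr : p / m ≤ 1 := by
    rw [div_le_one₀ hm0, hm]
    linarith [show 0 < 2 / β by positivity]
  refine ⟨(p / m)⁻¹ * C ^ (p / m), by positivity, fun r hr' y hy T => ?_⟩
  refine (sum_exp_le_one_add (by linarith) T).trans ?_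
  calc _ ≤ 1 + C * y ^ (-m) := by linarith [h r hr' y hy T]
    _ ≤ _ := one_add_le_exp_rpow (by positivity) (by positivity) hr
    _ = _ := by
      rw [Real.mul_rpow hC.le (by positivity), ← Real.rpow_mul hy.le, mul_assoc]
      congr 4
      field_simp

/-- Sums of `exp (-y |k|^r)` tend to one exponentially fast as `y` grows. -/
theorem sum_exp_le_exp_exp {β : ℝ} (hβ : 0 < β) :
    ∃ C : ℝ, 0 < C ∧ ∀ r, β ≤ r → ∀ y : ℝ, 1 ≤ y → ∀ T : Finset ℤ,
      ∑ k ∈ T, Real.exp (-(y * |(k : ℝ)| ^ r)) ≤ Real.exp (C * Real.exp (-(y / 2))) := by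
  obtain ⟨C, hC, h⟩ := sum_exp_erase_le hβ (m := 2 / β) (by
    rw [div_mul_cancel₀ _ hβ.ne']
    norm_num)
  refine ⟨C * (1 / 2) ^ (-(2 / β)), by positivity, fun r hr y hy T => ?_⟩
  refine (sum_exp_le_one_add (by linarith) T).trans ?_
  refine le_trans ?_ (Real.add_one_le_exp _)
  rw [add_comm]
  gcongr
  -- Since `y ≥ 1` and `|k|^r ≥ 1`, one has `y |k|^r ≥ y/2 + |k|^r / 2`; the second part keeps the
  -- sum convergent.
  calc ∑ k ∈ T.erase 0, Real.exp (-(y * |(k : ℝ)| ^ r))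
      ≤ ∑ k ∈ T.erase 0, Real.exp (-(y / 2)) * Real.exp (-(1 / 2 * |(k : ℝ)| ^ r)) := by
        refine Finset.sum_le_sum fun k hk => ?_
        have hk1 : (1 : ℝ) ≤ |(k : ℝ)| := by
          exact_mod_cast Int.one_le_abs (Finset.mem_erase.mp hk).1
        have hk2 : 1 ≤ |(k : ℝ)| ^ r := Real.one_le_rpow hk1 (by linarith)
        rw [← Real.exp_add]
        gcongr
        nlinarith
    _ = Real.exp (-(y / 2)) * ∑ k ∈ T.erase 0, Real.exp (-(1 / 2 * |(k : ℝ)| ^ r)) := by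
        rw [Finset.mul_sum]
    _ ≤ Real.exp (-(y / 2)) * (C * (1 / 2) ^ (-(2 / β))) := by
        gcongr
        exact h r hr _ (by norm_num) T
    _ = _ := by ring

end ExpSum

/-- Induction through `(n+1).choose (r+1) = (n+1)/(r+1) * n.choose r`, using `(n+1)/(r+1) ≤ n/r`. -/
theorem div_pow_le_choose {n r : ℕ} (h : r ≤ n) : ((n : ℝ) / r) ^ r ≤ n.choose r := by
  induction r generalizing n with
  | zero => simp
  | succ r ih =>
    obtain ⟨n, rfl⟩ : ∃ m, n = m + 1 := ⟨n - 1, by omega⟩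
    have hrn : r ≤ n := by omega
    have h1 : ((n + 1 : ℕ) : ℝ) / (r + 1 : ℕ) * n.choose r = (n + 1).choose (r + 1) := by
      rw [div_mul_eq_mul_div, div_eq_iff (by positivity)]
      exact_mod_cast Nat.add_one_mul_choose_eq n r
    rw [pow_succ', ← h1]
    gcongr
    refine le_trans ?_ (ih hrn)
    rcases Nat.eq_zero_or_pos r with rfl | hr
    · simp
    · gcongr ?_ ^ r
      rw [div_le_div_iff₀ (by positivity) (by positivity)]
      have : n * r + r ≤ n * r + n := by omega
      push_cast
      have : (r : ℝ) ≤ n := by exact_mod_cast hrn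
      nlinarith

/-! ### Reformulations of weak tractability -/

section WeakTractability

variable {H G : ℕ → Type*} [∀ d, NormedAddCommGroup (H d)] [∀ d, NormedSpace ℂ (H d)]
  [∀ d, NormedAddCommGroup (G d)] [∀ d, NormedSpace ℂ (G d)]

/-- The larger of `ε⁻¹` and `d` is at least half their sum, and both are at least one, so lowering
the exponents to `min s t` is harmless. -/
theorem tendsto_rpow_add_rpow_tractabilityFilter {s t : ℝ} (hs : 0 < s) (ht : 0 < t) :
    Tendsto (fun p : ℝ × ℕ => p.1⁻¹ ^ s + (p.2 : ℝ) ^ t) tractabilityFilter atTop := by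
  have h1 : Tendsto (fun p : ℝ × ℕ => p.1⁻¹ + (p.2 : ℝ)) tractabilityFilter atTop :=
    tendsto_comap.mono_left inf_le_left
  have h2 : Tendsto (fun p : ℝ × ℕ => ((p.1⁻¹ + (p.2 : ℝ)) / 2) ^ min s t)
      tractabilityFilter atTop :=
    (tendsto_rpow_atTop (lt_min hs ht)).comp (h1.atTop_div_const two_pos)
  refine tendsto_atTop_mono' _ ?_ h2
  have h3 : ∀ᶠ p : ℝ × ℕ in tractabilityFilter, p ∈ Set.Ioo (0 : ℝ) 1 ×ˢ Set.Ici 1 :=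
    Filter.mem_inf_of_right (mem_principal_self _)
  filter_upwards [h3] with p hp
  obtain ⟨⟨h0, h1⟩, hd⟩ := hp
  have hE : 1 ≤ p.1⁻¹ := (one_le_inv₀ h0).mpr h1.le
  have hd' : (1 : ℝ) ≤ p.2 := by exact_mod_cast hd
  have hm : 0 < min s t := lt_min hs ht
  rcases le_total p.1⁻¹ (p.2 : ℝ) with h | h
  · calc ((p.1⁻¹ + (p.2 : ℝ)) / 2) ^ min s t ≤ (p.2 : ℝ) ^ min s t := by
          gcongr
          linarith
      _ ≤ (p.2 : ℝ) ^ t := Real.rpow_le_rpow_of_exponent_le hd' (min_le_right _ _)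
      _ ≤ _ := le_add_of_nonneg_left (by positivity)
  · calc ((p.1⁻¹ + (p.2 : ℝ)) / 2) ^ min s t ≤ p.1⁻¹ ^ min s t := by
          gcongr
          linarith
      _ ≤ p.1⁻¹ ^ s := Real.rpow_le_rpow_of_exponent_le hE (min_le_left _ _)
      _ ≤ _ := le_add_of_nonneg_right (by positivity)

/-- The denominator tends to infinity, so any additive error depending only on `η` is absorbed. -/
theorem stwt_of_forall_log_le {s t : ℝ} (hs : 0 < s) (ht : 0 < t) (S : ∀ d, H d →L[ℂ] G d)
    (h : ∀ η : ℝ, 0 < η → ∃ K : ℝ, ∀ d : ℕ, 1 ≤ d → ∀ ε ∈ Set.Ioo (0 : ℝ) 1,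
      Real.log (infoComplexity (S d) ε) ≤ η * (ε⁻¹ ^ s + (d : ℝ) ^ t) + K) :
    STWT s t S := by
  rw [STWT, Metric.tendsto_nhds]
  intro η hη
  obtain ⟨K, hK⟩ := h (η / 2) (by positivity)
  have h3 : ∀ᶠ p : ℝ × ℕ in tractabilityFilter, p ∈ Set.Ioo (0 : ℝ) 1 ×ˢ Set.Ici 1 :=
    Filter.mem_inf_of_right (mem_principal_self _)
  filter_upwards [h3, (tendsto_rpow_add_rpow_tractabilityFilter hs ht).eventually_gt_atTop
    (max 0 (2 * K / η))] with p hp hM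
  obtain ⟨hε, hd⟩ := hp
  have hM0 := (le_max_left _ _).trans_lt hM
  have hMK := (le_max_right _ _).trans_lt hM
  rw [div_lt_iff₀ hη] at hMK
  rw [dist_zero_right, Real.norm_eq_abs, abs_of_nonneg
    (div_nonneg (Real.log_natCast_nonneg _) hM0.le), div_lt_iff₀ hM0]
  linarith [hK p.2 hd p.1 hε]

theorem STWT.tendsto_comp {s t : ℝ} {S : ∀ d, H d →L[ℂ] G d} (h : STWT s t S) (ε : ℕ → ℝ)
    (hε : ∀ d, 1 ≤ d → ε d ∈ Set.Ioo (0 : ℝ) 1) :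
    Tendsto (fun d : ℕ => Real.log (infoComplexity (S d) (ε d)) / ((ε d)⁻¹ ^ s + (d : ℝ) ^ t))
      atTop (𝓝 0) := by
  have hlim : Tendsto (fun d : ℕ => (ε d, d)) atTop tractabilityFilter := by
    refine tendsto_inf.mpr ⟨tendsto_comap_iff.mpr ?_, tendsto_principal.mpr ?_⟩
    · refine tendsto_atTop_mono' _ ?_ tendsto_natCast_atTop_atTop
      filter_upwards [eventually_ge_atTop 1] with d hd
      have := (hε d hd).1
      exact le_add_of_nonneg_left (by positivity)
    · filter_upwards [eventually_ge_atTop 1] with d hd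
      exact ⟨hε d hd, hd⟩
  exact Tendsto.comp (f := fun d : ℕ => (ε d, d)) h hlim

theorem wt_iff_stwt_one_one (S : ∀ d, H d →L[ℂ] G d) : WT S ↔ STWT 1 1 S := by
  simp only [WT, STWT, Real.rpow_one]

theorem UWT.stwt {S : ∀ d, H d →L[ℂ] G d} (h : UWT S) {s t : ℝ} (hs : 0 < s) (ht : 0 < t) :
    STWT s t S := h s t hs ht

end WeakTractability

theorem inv_sqrt_one_add_mem_Ioo {y : ℝ} (hy : 0 < y) : (√(1 + y))⁻¹ ∈ Set.Ioo (0 : ℝ) 1 := by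
  have : 1 < √(1 + y) := by
    rw [Real.lt_sqrt zero_le_one]
    linarith
  exact ⟨by positivity, inv_lt_one_of_one_lt₀ this⟩

theorem infoComplexity_inv_sqrt {a b : ℕ → ℝ} (ha : ∀ j, 1 ≤ j → 0 < a j)
    (hb : ∀ j, 1 ≤ j → 0 < b j) (d : ℕ) {y : ℝ} (hy : 0 < y) :
    infoComplexity (sobolevEmbedding a b d) (√(1 + y))⁻¹ = (freqSet a b d y).ncard := by
  rw [infoComplexity_sobolevEmbedding ha hb d (inv_sqrt_one_add_mem_Ioo hy), inv_inv,
    Real.sq_sqrt (by positivity), add_sub_cancel_left]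

theorem sqrt_rpow {y : ℝ} (hy : 0 ≤ y) (s : ℝ) : √y ^ s = y ^ (s / 2) := by
  rw [Real.sqrt_eq_rpow, ← Real.rpow_mul hy]
  congr 1
  ring

/-! ### Necessary conditions for the weak notions -/

section Necessity

variable {a b : ℕ → ℝ}

theorem mul_log_two_le_log_infoComplexity (ha : ∀ j, 1 ≤ j → 0 < a j)
    (ha_mono : MonotoneOn a (Set.Ici 1)) (hb : ∀ j, 1 ≤ j → 0 < b j) {d : ℕ} (hd : 1 ≤ d) :
    d * Real.log 2 ≤
      Real.log (infoComplexity (sobolevEmbedding a b d) (√(1 + 2 * d * a d))⁻¹) := by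
  have had := ha d hd
  have hd0 : (0 : ℝ) < d := by exact_mod_cast hd
  have hy : (0 : ℝ) < d * a d := by positivity
  rw [infoComplexity_inv_sqrt ha hb d (by positivity), ← Real.log_pow]
  refine Real.log_le_log (by positivity) ?_
  have h : (d : ℝ) * a d < 2 * d * a d := by linarith
  exact_mod_cast two_pow_le_ncard_freqSet ha ha_mono hb hd h

/-- Along `ε⁻² = 1 + 2 d a_d` the numerator is at least `d ln 2`, and `d^t ≤ d` cannot beat it.
Hence `(1 + 2 d a_d)^(s/2) / d → ∞`, which amounts to the growth of `a_d` over `d^(2/s - 1)`. -/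
theorem tendsto_div_rpow_of_stwt (ha : ∀ j, 1 ≤ j → 0 < a j)
    (ha_mono : MonotoneOn a (Set.Ici 1)) (hb : ∀ j, 1 ≤ j → 0 < b j) {s t : ℝ} (hs : 0 < s)
    (hs2 : s ≤ 2) (ht1 : t ≤ 1) (h : STWT s t (sobolevEmbedding a b)) :
    Tendsto (fun j : ℕ => a j / (j : ℝ) ^ ((2 - s) / s)) atTop atTop := by
  have hlim := h.tendsto_comp (fun d => (√(1 + 2 * d * a d))⁻¹) fun d hd => by
    have had := ha d hd
    have hd0 : (0 : ℝ) < d := by exact_mod_cast hd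
    exact inv_sqrt_one_add_mem_Ioo (by positivity)
  refine tendsto_atTop.mpr fun B' => ?_
  set B := max B' 0 with hB
  have hB0 : 0 ≤ B := le_max_right _ _
  -- With this `Q`, the bound `Q d < (1 + 2 d a_d)^(s/2)` reads `(2B + 1) d^(2/s) < 1 + 2 d a_d`;
  -- the extra `1` in `2B + 1` pays for the `1` on the right.
  set Q := (2 * B + 1) ^ (s / 2) with hQ
  have hlog2 : 0 < Real.log 2 := Real.log_pos one_lt_two
  filter_upwards [hlim.eventually_lt_const (show 0 < Real.log 2 / (1 + Q) by positivity),
    eventually_ge_atTop 1] with d hlt hd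
  refine (le_max_left B' 0).trans ?_
  rw [← hB]
  have had := ha d hd
  have hd1 : (1 : ℝ) ≤ d := by exact_mod_cast hd
  have hd0 : (0 : ℝ) < d := by linarith
  rw [inv_inv, sqrt_rpow (by positivity), div_lt_div_iff₀ (by positivity) (by positivity)] at hlt
  have h1 := mul_log_two_le_log_infoComplexity ha ha_mono hb hd
  have hdt : (d : ℝ) ^ t ≤ d := by
    simpa using Real.rpow_le_rpow_of_exponent_le hd1 ht1
  have h2 : Q * d < (1 + 2 * d * a d) ^ (s / 2) := by
    have h3 : (d * Real.log 2) * (1 + Q) <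
        Real.log 2 * ((1 + 2 * d * a d) ^ (s / 2) + d) := by
      refine (mul_le_mul_of_nonneg_right h1 (by positivity)).trans_lt (hlt.trans_le ?_)
      gcongr
    have h4 : Real.log 2 * (d * (1 + Q)) < Real.log 2 * ((1 + 2 * d * a d) ^ (s / 2) + d) := by
      linarith
    linarith [lt_of_mul_lt_mul_left h4 hlog2.le]
  have h3 : ((2 * B + 1) * (d : ℝ) ^ (2 / s)) ^ (s / 2) < (1 + 2 * d * a d) ^ (s / 2) := by
    rw [Real.mul_rpow (by positivity) (by positivity), ← Real.rpow_mul hd0.le,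
      show 2 / s * (s / 2) = 1 by field_simp, Real.rpow_one]
    exact h2
  have h4 := (Real.rpow_lt_rpow_iff (by positivity) (by positivity) (by positivity)).mp h3
  have h5 : (d : ℝ) ^ (2 / s) = d * (d : ℝ) ^ ((2 - s) / s) := by
    rw [← Real.rpow_one_add' hd0.le]
    · congr 1
      field_simp
      ring
    · have : 0 ≤ (2 - s) / s := div_nonneg (by linarith) hs.le
      linarith
  have h6 : 1 ≤ (d : ℝ) ^ ((2 - s) / s) :=
    Real.one_le_rpow hd1 (div_nonneg (by linarith) hs.le)
  rw [h5] at h4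
  rw [le_div_iff₀ (by positivity)]
  set Z := (d : ℝ) ^ ((2 - s) / s)
  have h7 : d * (2 * (B * Z)) ≤ d * (2 * a d) := by nlinarith
  linarith [le_of_mul_le_mul_left h7 hd0]

theorem tendsto_log_div_log_of_uwt (ha : ∀ j, 1 ≤ j → 0 < a j)
    (ha_mono : MonotoneOn a (Set.Ici 1)) (hb : ∀ j, 1 ≤ j → 0 < b j)
    (h : UWT (sobolevEmbedding a b)) :
    Tendsto (fun j : ℕ => Real.log (a j) / Real.log j) atTop atTop := by
  refine tendsto_atTop.mpr fun M' => ?_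
  set M := max M' 0 with hM
  have hM0 : 0 ≤ M := le_max_right _ _
  -- The choice `s = 2/(M+1)` makes the exponent `(2 - s)/s` equal to `M`, so eventually `a_j ≥
  -- j^M`.
  have hs2 : 2 / (M + 1) ≤ 2 := div_le_self (by norm_num) (by linarith)
  have hlim := tendsto_div_rpow_of_stwt ha ha_mono hb (by positivity) hs2 le_rfl
    (h.stwt (s := 2 / (M + 1)) (by positivity) one_pos)
  have hexp : (2 - 2 / (M + 1)) / (2 / (M + 1)) = M := by
    field_simp
    ring
  rw [hexp] at hlim
  filter_upwards [hlim.eventually_ge_atTop 1, eventually_ge_atTop 2] with j hj hj2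
  have hj0 : (0 : ℝ) < j := by exact_mod_cast (by omega : 0 < j)
  have hlogj : 0 < Real.log j := Real.log_pos (by exact_mod_cast hj2)
  refine (le_max_left M' 0).trans ?_
  rw [le_div_iff₀ hlogj, ← Real.log_rpow hj0]
  refine Real.log_le_log (by positivity) ?_
  rwa [le_div_iff₀ (by positivity), one_mul] at hj

/-- Use 0-1 vectors with `m ≈ d^t` ones. Their number has logarithm at least of order `m ln d`,
whereas at `ε⁻² = 1 + 2 m a_d` the denominator is at most `1 + 2 m a_d + m`; so `a_d` must outgrow
`ln d`. -/
theorem tendsto_div_log_of_stwt (ha : ∀ j, 1 ≤ j → 0 < a j)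
    (ha_mono : MonotoneOn a (Set.Ici 1)) (hb : ∀ j, 1 ≤ j → 0 < b j) {t : ℝ} (ht : 0 < t)
    (ht1 : t < 1) (h : STWT 2 t (sobolevEmbedding a b)) :
    Tendsto (fun j : ℕ => a j / Real.log j) atTop atTop := by
  set m : ℕ → ℕ := fun d => ⌈(d : ℝ) ^ t⌉₊ with hm
  have hm1 : ∀ d, 1 ≤ d → 1 ≤ m d := fun d hd => by
    have : (0 : ℝ) < d := by exact_mod_cast hd
    exact Nat.one_le_ceil_iff.mpr (by positivity)
  have hlim := h.tendsto_comp (fun d => (√(1 + 2 * m d * a d))⁻¹) fun d hd => by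
    have had := ha d hd
    have hd0 : (0 : ℝ) < m d := by exact_mod_cast hm1 d hd
    exact inv_sqrt_one_add_mem_Ioo (by positivity)
  have hlog : Tendsto (fun d : ℕ => Real.log d) atTop atTop :=
    Real.tendsto_log_atTop.comp tendsto_natCast_atTop_atTop
  refine tendsto_atTop.mpr fun B' => ?_
  set B := max B' 0 with hB
  have hB0 : 0 ≤ B := le_max_right _ _
  filter_upwards [hlim.eventually_lt_const (show 0 < (1 - t) / (4 * (B + 1)) by
      have : 0 < 1 - t := by linarith
      positivity), eventually_ge_atTop 2, hlog.eventually_ge_atTop 1,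
    -- Ensures that `ln(d/m) ≥ (1 - t) ln d - ln 2` is still at least `(1 - t)/2 * ln d`.
    hlog.eventually_ge_atTop (2 * Real.log 2 / (1 - t))] with d hlt hd hlog1 hlog2
  refine (le_max_left B' 0).trans ?_
  rw [← hB]
  have hd' : 1 ≤ d := by omega
  have had := ha d hd'
  have hd1 : (1 : ℝ) ≤ d := by exact_mod_cast hd'
  have hd0 : (0 : ℝ) < d := by linarith
  have hmd : (1 : ℝ) ≤ m d := by exact_mod_cast hm1 d hd'
  have hmt : (d : ℝ) ^ t ≤ m d := Nat.le_ceil _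
  have hdt : 1 ≤ (d : ℝ) ^ t := Real.one_le_rpow hd1 ht.le
  have hmt2 : (m d : ℝ) ≤ 2 * (d : ℝ) ^ t := by
    linarith [Nat.ceil_lt_add_one (show 0 ≤ (d : ℝ) ^ t by positivity)]
  have hmled : m d ≤ d := Nat.ceil_le.mpr (by
    simpa using Real.rpow_le_rpow_of_exponent_le hd1 ht1.le)
  rw [div_le_iff₀ (by linarith)] at hlog2
  have h1 : m d * ((1 - t) / 2 * Real.log d) ≤
      Real.log (infoComplexity (sobolevEmbedding a b d) (√(1 + 2 * m d * a d))⁻¹) := by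
    have hy : 0 < m d * a d := by positivity
    rw [infoComplexity_inv_sqrt ha hb d (by positivity)]
    have h2 := (div_pow_le_choose hmled).trans (Nat.cast_le.mpr
      (choose_le_ncard_freqSet ha ha_mono hb (x := 2 * m d * a d) (by linarith)))
    have h3 := Real.log_le_log (by positivity) h2
    rw [Real.log_pow, Real.log_div (by positivity) (by positivity)] at h3
    refine le_trans ?_ h3
    gcongr
    have h4 := Real.log_le_log (by positivity) hmt2
    rw [Real.log_mul (by norm_num) (by positivity), Real.log_rpow hd0] at h4
    linarith
  have ht1' : 0 < 1 - t := by linarith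
  rw [inv_inv, sqrt_rpow (by positivity), div_self two_ne_zero, Real.rpow_one,
    div_lt_div_iff₀ (by positivity) (by positivity)] at hlt
  have h2 : m d * ((1 - t) / 2 * Real.log d) * (4 * (B + 1)) <
      (1 - t) * (1 + 2 * m d * a d + m d) := by
    refine (mul_le_mul_of_nonneg_right h1 (by positivity)).trans_lt (hlt.trans_le ?_)
    gcongr
  have h3 : (m d * (1 - t)) * (2 * (B + 1) * Real.log d) <
      (m d * (1 - t)) * (2 + 2 * a d) := by nlinarith
  have h4 := lt_of_mul_lt_mul_left h3 (by positivity)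
  rw [le_div_iff₀ (by linarith)]
  linarith

end Necessity

/-! ### Elementary inequalities for powers and sums -/

theorem exists_rpow_le_mul_add {θ η : ℝ} (hθ0 : 0 ≤ θ) (hθ : θ < 1) (hη : 0 < η) :
    ∃ K : ℝ, ∀ M : ℝ, 0 ≤ M → M ^ θ ≤ η * M + K := by
  refine ⟨(η ^ (θ - 1)⁻¹) ^ θ, fun M hM => ?_⟩
  rcases le_total M (η ^ (θ - 1)⁻¹) with h | h
  · have : M ^ θ ≤ (η ^ (θ - 1)⁻¹) ^ θ := by gcongr
    nlinarith [mul_nonneg hη.le hM]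
  · have hM0 : 0 < M := lt_of_lt_of_le (by positivity) h
    have h1 : M ^ (θ - 1) ≤ η := by
      calc M ^ (θ - 1) ≤ (η ^ (θ - 1)⁻¹) ^ (θ - 1) :=
            Real.rpow_le_rpow_of_nonpos (by positivity) h (by linarith)
        _ = η := Real.rpow_inv_rpow hη.le (by linarith)
    have h2 : M ^ θ = M ^ (θ - 1) * M := by
      rw [← Real.rpow_add_one hM0.ne']
      ring_nf
    rw [h2]
    nlinarith [show 0 ≤ (η ^ (θ - 1)⁻¹) ^ θ by positivity]

/-- The product is at most `(x^s + y^t)^(u/t + v/s)`, a sublinear power of the denominator in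
`(s,t)`-weak tractability. -/
theorem exists_rpow_mul_rpow_le {s t u v η : ℝ} (hs : 0 < s) (ht : 0 < t) (hu : 0 ≤ u)
    (hv : 0 ≤ v) (h : u / t + v / s < 1) (hη : 0 < η) :
    ∃ K : ℝ, ∀ x y : ℝ, 0 < x → 0 < y → y ^ u * x ^ v ≤ η * (x ^ s + y ^ t) + K := by
  obtain ⟨K, hK⟩ := exists_rpow_le_mul_add (θ := u / t + v / s) (by positivity) h hη
  refine ⟨K, fun x y hx hy => le_trans ?_ (hK (x ^ s + y ^ t) (by positivity))⟩
  rw [Real.rpow_add (by positivity)]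
  have h1 : y ^ u = (y ^ t) ^ (u / t) := by
    rw [← Real.rpow_mul hy.le, mul_div_cancel₀ _ ht.ne']
  have h2 : x ^ v = (x ^ s) ^ (v / s) := by
    rw [← Real.rpow_mul hx.le, mul_div_cancel₀ _ hs.ne']
  rw [h1, h2]
  have h3 : 0 < x ^ s := by positivity
  have h4 : 0 < y ^ t := by positivity
  gcongr <;> linarith

theorem sum_range_inv_sqrt_le (n : ℕ) :
    ∑ j ∈ Finset.range n, (√((j : ℝ) + 1))⁻¹ ≤ 2 * √n := by
  induction n with
  | zero => simp
  | succ n ih =>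
    rw [Finset.sum_range_succ]
    have h0 : 0 < √((n : ℝ) + 1) := by positivity
    have h1 := Real.sq_sqrt (show (0 : ℝ) ≤ n by positivity)
    have h2 := Real.sq_sqrt (show (0 : ℝ) ≤ (n : ℝ) + 1 by positivity)
    have h3 : (√((n : ℝ) + 1))⁻¹ ≤ 2 * √((n : ℝ) + 1) - 2 * √n := by
      rw [inv_le_iff_one_le_mul₀ h0]
      nlinarith [sq_nonneg (√((n : ℝ) + 1) - √n)]
    push_cast
    linarith

/-- With `sum_ite_le_sq`, this bounds a total over all coordinates by a multiple of `X` independent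
of `d`: `(X/j)^(1/2)` is used up to `X`, and the summable `(X/j)²` beyond. -/
theorem sum_ite_le_sqrt {X : ℝ} (hX : 1 ≤ X) (d : ℕ) :
    ∑ j ∈ Finset.range d, (if (j : ℝ) + 1 ≤ X then √X * (√((j : ℝ) + 1))⁻¹ else 0) ≤ 2 * X := by
  rw [← Finset.sum_filter, ← Finset.mul_sum]
  have hsub : (Finset.range d).filter (fun j : ℕ => (j : ℝ) + 1 ≤ X) ⊆ Finset.range ⌊X⌋₊ := by
    intro j hj
    rw [Finset.mem_filter] at hj
    rw [Finset.mem_range, Nat.lt_iff_add_one_le]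
    exact Nat.le_floor (by exact_mod_cast hj.2)
  calc _ ≤ √X * ∑ j ∈ Finset.range ⌊X⌋₊, (√((j : ℝ) + 1))⁻¹ := by
        gcongr
    _ ≤ √X * (2 * √X) := by
        gcongr
        refine (sum_range_inv_sqrt_le _).trans ?_
        gcongr
        exact Nat.floor_le (by linarith)
    _ = 2 * X := by
        rw [mul_left_comm, Real.mul_self_sqrt (by linarith)]

theorem sum_ite_le_sq {X : ℝ} (hX : 1 ≤ X) (d : ℕ) :
    ∑ j ∈ Finset.range d, (if (j : ℝ) + 1 ≤ X then 0 else X ^ 2 * (((j : ℝ) + 1) ^ 2)⁻¹)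
      ≤ 2 * X := by
  have hfl : 1 ≤ ⌊X⌋₊ := Nat.one_le_floor_iff _ |>.mpr hX
  have hfl1 : (1 : ℝ) ≤ ⌊X⌋₊ := by exact_mod_cast hfl
  have hsum : ∀ n : ℕ, ∑ j ∈ Finset.range n, (if (j : ℝ) + 1 ≤ X then 0 else
      (((j : ℝ) + 1) ^ 2)⁻¹) ≤ ∑ i ∈ Finset.Ioc ⌊X⌋₊ (max ⌊X⌋₊ n), ((i : ℝ) ^ 2)⁻¹ := by
    intro n
    have : ∀ j : ℕ, (if (j : ℝ) + 1 ≤ X then 0 else (((j : ℝ) + 1) ^ 2)⁻¹) =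
        if ¬ ((j : ℝ) + 1 ≤ X) then (((j + 1 : ℕ) : ℝ) ^ 2)⁻¹ else 0 := fun j => by
      split_ifs <;> simp_all
    simp only [this]
    rw [← Finset.sum_filter]
    refine (Finset.sum_map _ (addRightEmbedding 1) (fun i : ℕ => ((i : ℝ) ^ 2)⁻¹)).symm.le.trans ?_
    refine Finset.sum_le_sum_of_subset_of_nonneg (fun i hi => ?_) fun i _ _ => by positivity
    simp only [Finset.mem_map, Finset.mem_filter, Finset.mem_range, addRightEmbedding_apply] at hi
    obtain ⟨j, ⟨hjn, hj⟩, rfl⟩ := hi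
    rw [Finset.mem_Ioc]
    refine ⟨(Nat.floor_lt (by linarith)).mpr ?_, le_max_of_le_right hjn⟩
    push_cast
    linarith
  have h2 := (hsum d).trans (sum_Ioc_inv_sq_le_sub (by omega) (le_max_left _ _))
  have h3 : X ≤ 2 * ⌊X⌋₊ := by linarith [Nat.lt_floor_add_one X]
  have h4 : (0 : ℝ) ≤ ((max ⌊X⌋₊ d : ℕ) : ℝ)⁻¹ := by positivity
  have h5 : ((⌊X⌋₊ : ℕ) : ℝ)⁻¹ ≤ 2 / X := by
    rw [inv_le_iff_one_le_mul₀ (by linarith), div_mul_eq_mul_div, one_le_div₀ (by linarith)]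
    exact h3
  calc _ = X ^ 2 * ∑ j ∈ Finset.range d, (if (j : ℝ) + 1 ≤ X then 0 else
      (((j : ℝ) + 1) ^ 2)⁻¹) := by
        rw [Finset.mul_sum]
        simp only [mul_ite, mul_zero]
    _ ≤ X ^ 2 * (2 / X) := by
        gcongr
        linarith
    _ = 2 * X := by
        field_simp

theorem sum_range_inv_sq_le (d : ℕ) :
    ∑ j ∈ Finset.range d, (((j : ℝ) + 1) ^ 2)⁻¹ ≤ 3 := by
  have h := sum_ite_le_sq le_rfl d
  have h2 : ∑ j ∈ Finset.range d, (((j : ℝ) + 1) ^ 2)⁻¹ ≤ ∑ j ∈ Finset.range d,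
      ((if (j : ℝ) + 1 ≤ 1 then 0 else 1 ^ 2 * (((j : ℝ) + 1) ^ 2)⁻¹) +
        if j = 0 then 1 else 0) := by
    refine Finset.sum_le_sum fun j _ => ?_
    rcases Nat.eq_zero_or_pos j with rfl | hj
    · simp
    · have : (0 : ℝ) < j := by exact_mod_cast hj
      rw [if_neg (by linarith)]
      simp [hj.ne']
  rw [Finset.sum_add_distrib] at h2
  have h3 : ∑ j ∈ Finset.range d, (if j = 0 then (1 : ℝ) else 0) ≤ 1 := by
    rw [Finset.sum_ite_eq']
    split_ifs <;> norm_num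
  linarith

theorem sum_range_ite_lt_le (d j₀ : ℕ) {K : ℝ} (hK : 0 ≤ K) :
    ∑ j ∈ Finset.range d, (if j + 1 < j₀ then K else 0) ≤ j₀ * K := by
  rw [← Finset.sum_filter, Finset.sum_const, nsmul_eq_mul]
  gcongr
  refine (Finset.card_le_card (t := Finset.range j₀) fun j hj => ?_).trans_eq
    (Finset.card_range j₀)
  rw [Finset.mem_filter] at hj
  rw [Finset.mem_range]
  omega

/-! ### Sufficient conditions for the weak notions -/

section Sufficiency

variable {a b : ℕ → ℝ}

/-- Chernoff-type bound for the information complexity. -/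
theorem log_infoComplexity_le (ha : ∀ j, 1 ≤ j → 0 < a j) (hb : ∀ j, 1 ≤ j → 0 < b j)
    {d : ℕ} {ε l : ℝ} (hε : ε ∈ Set.Ioo (0 : ℝ) 1) (hl : 0 ≤ l) (G : ℕ → ℝ)
    (hG : ∀ j, 1 ≤ j → j ≤ d → ∀ T : Finset ℤ,
      ∑ m ∈ T, Real.exp (-(l * a j * |(m : ℝ)| ^ (2 * b j))) ≤ Real.exp (G j)) :
    Real.log (infoComplexity (sobolevEmbedding a b d) ε) ≤
      l * ε⁻¹ ^ 2 + ∑ j ∈ Finset.range d, G (j + 1) := by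
  have hinv : 1 < ε⁻¹ ^ 2 := one_lt_pow₀ ((one_lt_inv₀ hε.1).mpr hε.2) two_ne_zero
  rw [infoComplexity_sobolevEmbedding ha hb d hε, ← Fin.sum_univ_eq_sum_range (fun j => G (j + 1))]
  have h := log_ncard_freqSet_le_of_forall_sum_exp_le ha hb (d := d) (x := ε⁻¹ ^ 2 - 1) (l := l)
    (by linarith) hl (fun j => G (j + 1)) fun j T => hG (j + 1) (Nat.le_add_left 1 _) j.2 T
  nlinarith

theorem exists_sum_exp_le_rpow {β p : ℝ} (hβ : 0 < β) (hbβ : ∀ j, 1 ≤ j → β ≤ b j)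
    (hp : 0 < p) : ∃ C : ℝ, 0 < C ∧ ∀ j, 1 ≤ j → ∀ y : ℝ, 0 < y → ∀ T : Finset ℤ,
      ∑ m ∈ T, Real.exp (-(y * |(m : ℝ)| ^ (2 * b j))) ≤ Real.exp (C * y ^ (-p)) := by
  obtain ⟨C, hC, h⟩ := sum_exp_le_exp_rpow (β := 2 * β) (by positivity) hp
  exact ⟨C, hC, fun j hj y hy T => h _ (by linarith [hbβ j hj]) y hy T⟩

theorem exists_sum_exp_le_exp {β : ℝ} (hβ : 0 < β) (hbβ : ∀ j, 1 ≤ j → β ≤ b j) :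
    ∃ C : ℝ, 0 < C ∧ ∀ j, 1 ≤ j → ∀ y : ℝ, 1 ≤ y → ∀ T : Finset ℤ,
      ∑ m ∈ T, Real.exp (-(y * |(m : ℝ)| ^ (2 * b j))) ≤
        Real.exp (C * Real.exp (-(y / 2))) := by
  obtain ⟨C, hC, h⟩ := sum_exp_le_exp_exp (β := 2 * β) (by positivity)
  exact ⟨C, hC, fun j hj y hy T => h _ (by linarith [hbβ j hj]) y hy T⟩

theorem le_of_monotoneOn_Ici_one (ha_mono : MonotoneOn a (Set.Ici 1)) {j : ℕ} (hj : 1 ≤ j) :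
    a 1 ≤ a j :=
  ha_mono (Set.mem_Ici.mpr le_rfl) (Set.mem_Ici.mpr hj) hj

/-- Take `l = ε²`, so the linear term is `1` and each coordinate contributes `O(ε^(-2p))`. The total
`d ε^(-2p)` is negligible if `1/t + 2p/s < 1`, which dictates `p`. -/
theorem stwt_of_one_lt_right (ha : ∀ j, 1 ≤ j → 0 < a j) (ha_mono : MonotoneOn a (Set.Ici 1))
    (hb : ∀ j, 1 ≤ j → 0 < b j) {β : ℝ} (hβ : 0 < β) (hbβ : ∀ j, 1 ≤ j → β ≤ b j) {s t : ℝ}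
    (hs : 0 < s) (ht : 1 < t) : STWT s t (sobolevEmbedding a b) := by
  have ht0 : 0 < t := by linarith
  have hinv : 0 < 1 - 1 / t := by
    rw [sub_pos, div_lt_one ht0]
    exact ht
  set p := s * (1 - 1 / t) / 4 with hp
  have hp0 : 0 < p := by positivity
  obtain ⟨C, hC, hexp⟩ := exists_sum_exp_le_rpow hβ hbβ hp0
  have ha1 := ha 1 le_rfl
  have hK0 : 0 < C * a 1 ^ (-p) := by positivity
  refine stwt_of_forall_log_le hs ht0 _ fun η hη => ?_
  obtain ⟨K, hK⟩ := exists_rpow_mul_rpow_le (u := 1) (v := 2 * p) (η := η / (C * a 1 ^ (-p)))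
    hs ht0 zero_le_one (by positivity) (by
      have : 2 * p / s = (1 - 1 / t) / 2 := by
        rw [hp]
        field_simp
        ring
      rw [this]
      linarith) (by positivity)
  refine ⟨1 + C * a 1 ^ (-p) * K, fun d hd ε hε => ?_⟩
  have hE : 0 < ε⁻¹ := inv_pos.mpr hε.1
  have hd0 : (0 : ℝ) < d := by exact_mod_cast hd
  have h := log_infoComplexity_le ha hb (d := d) hε (l := (ε⁻¹ ^ 2)⁻¹) (by positivity)
    (fun _ => C * a 1 ^ (-p) * ε⁻¹ ^ (2 * p)) fun j hj _ T => by
      have haj := ha j hj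
      refine (hexp j hj _ (by positivity) T).trans (Real.exp_le_exp.mpr ?_)
      have h1 : ((ε⁻¹ ^ 2)⁻¹ * a j) ^ (-p) = a j ^ (-p) * ε⁻¹ ^ (2 * p) := by
        rw [Real.mul_rpow (by positivity) haj.le, Real.rpow_neg (by positivity) p,
          Real.inv_rpow (by positivity), inv_inv, Real.rpow_mul hE.le, Real.rpow_two, mul_comm]
      rw [h1, mul_assoc]
      gcongr ?_ * (?_ * _)
      exact Real.rpow_le_rpow_of_nonpos ha1 (le_of_monotoneOn_Ici_one ha_mono hj) (by linarith)
  rw [inv_mul_cancel₀ (by positivity), Finset.sum_const, Finset.card_range, nsmul_eq_mul] at h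
  have h2 := mul_le_mul_of_nonneg_left (hK ε⁻¹ d hE hd0) hK0.le
  rw [Real.rpow_one] at h2
  calc _ ≤ _ := h
    _ = 1 + C * a 1 ^ (-p) * (d * ε⁻¹ ^ (2 * p)) := by ring
    _ ≤ _ := add_le_add_right h2 1
    _ = _ := by field_simp; ring

/-- Take `l = d^δ` with the power bound for `p = 1/δ`: each coordinate contributes `O(1/d)`, hence
`O(1)` in total. What remains is `d^δ ε⁻²`, negligible once `δ/t + 2/s < 1`. -/
theorem stwt_of_two_lt_left (ha : ∀ j, 1 ≤ j → 0 < a j) (ha_mono : MonotoneOn a (Set.Ici 1))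
    (hb : ∀ j, 1 ≤ j → 0 < b j) {β : ℝ} (hβ : 0 < β) (hbβ : ∀ j, 1 ≤ j → β ≤ b j) {s t : ℝ}
    (hs : 2 < s) (ht : 0 < t) : STWT s t (sobolevEmbedding a b) := by
  have hs0 : 0 < s := by linarith
  have hinv : 0 < 1 - 2 / s := by
    rw [sub_pos, div_lt_one hs0]
    exact hs
  set δ := t * (1 - 2 / s) / 2 with hδ
  have hδ0 : 0 < δ := by positivity
  obtain ⟨C, hC, hexp⟩ := exists_sum_exp_le_rpow hβ hbβ (p := δ⁻¹) (by positivity)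
  have ha1 := ha 1 le_rfl
  refine stwt_of_forall_log_le hs0 ht _ fun η hη => ?_
  obtain ⟨K, hK⟩ := exists_rpow_mul_rpow_le (u := δ) (v := 2) hs0 ht hδ0.le two_pos.le (by
      have : δ / t = (1 - 2 / s) / 2 := by
        rw [hδ]
        field_simp
      rw [this]
      linarith) hη
  refine ⟨K + C * a 1 ^ (-δ⁻¹), fun d hd ε hε => ?_⟩
  have hE : 0 < ε⁻¹ := inv_pos.mpr hε.1
  have hd0 : (0 : ℝ) < d := by exact_mod_cast hd
  have h := log_infoComplexity_le ha hb (d := d) hε (l := (d : ℝ) ^ δ) (by positivity)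
    (fun _ => C * a 1 ^ (-δ⁻¹) * (d : ℝ)⁻¹) fun j hj _ T => by
      have haj := ha j hj
      refine (hexp j hj _ (by positivity) T).trans (Real.exp_le_exp.mpr ?_)
      have h1 : ((d : ℝ) ^ δ * a j) ^ (-δ⁻¹) = a j ^ (-δ⁻¹) * (d : ℝ)⁻¹ := by
        rw [Real.mul_rpow (by positivity) haj.le, ← Real.rpow_mul hd0.le, mul_neg,
          mul_inv_cancel₀ hδ0.ne', Real.rpow_neg_one, mul_comm]
      rw [h1, mul_assoc]
      gcongr ?_ * (?_ * _)
      exact Real.rpow_le_rpow_of_nonpos ha1 (le_of_monotoneOn_Ici_one ha_mono hj)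
        (by simpa using hδ0.le)
  rw [Finset.sum_const, Finset.card_range, nsmul_eq_mul] at h
  have h2 := hK ε⁻¹ d hE hd0
  rw [Real.rpow_two] at h2
  have h3 : (d : ℝ) * (C * a 1 ^ (-δ⁻¹) * (d : ℝ)⁻¹) = C * a 1 ^ (-δ⁻¹) := by
    field_simp
  linarith

/-- Take `l = η`. All but finitely many coordinates have `C/(η a_j) ≤ η`, so they add at most `η d`.
-/
theorem stwt_two_one_of_tendsto (ha : ∀ j, 1 ≤ j → 0 < a j)
    (ha_mono : MonotoneOn a (Set.Ici 1))
    (hb : ∀ j, 1 ≤ j → 0 < b j) {β : ℝ} (hβ : 0 < β) (hbβ : ∀ j, 1 ≤ j → β ≤ b j)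
    (h : Tendsto a atTop atTop) : STWT 2 1 (sobolevEmbedding a b) := by
  obtain ⟨C, hC, hexp⟩ := exists_sum_exp_le_rpow hβ hbβ (p := 1) one_pos
  have ha1 := ha 1 le_rfl
  refine stwt_of_forall_log_le two_pos one_pos _ fun η hη => ?_
  obtain ⟨j₀, hj₀⟩ := eventually_atTop.mp (h.eventually_ge_atTop (C / η / η))
  refine ⟨j₀ * (C * (η * a 1)⁻¹), fun d hd ε hε => ?_⟩
  have hb1 := log_infoComplexity_le ha hb (d := d) hε (l := η) hη.le
    (fun j => (if j < j₀ then C * (η * a 1)⁻¹ else 0) + η) fun j hj _ T => by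
      have haj := ha j hj
      refine (hexp j hj _ (by positivity) T).trans (Real.exp_le_exp.mpr ?_)
      rw [Real.rpow_neg_one]
      split_ifs with hlt
      · have : C * (η * a j)⁻¹ ≤ C * (η * a 1)⁻¹ := by
          gcongr
          exact le_of_monotoneOn_Ici_one ha_mono hj
        linarith
      · have := hj₀ j (not_lt.mp hlt)
        rw [div_div, div_le_iff₀ (by positivity)] at this
        rw [zero_add, ← div_eq_mul_inv, div_le_iff₀ (by positivity)]
        linarith
  rw [Finset.sum_add_distrib, Finset.sum_const, Finset.card_range, nsmul_eq_mul] at hb1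
  have h2 := sum_range_ite_lt_le d j₀ (K := C * (η * a 1)⁻¹) (by positivity)
  rw [Real.rpow_two, Real.rpow_one]
  linarith

/-- Take `l = η`. Eventually `η a_j ≥ 4 ln j`, so the exponentially small bound is `O(j⁻²)` and the
coordinates contribute a bounded total, whatever `d` is. -/
theorem stwt_two_of_tendsto_div_log (ha : ∀ j, 1 ≤ j → 0 < a j)
    (ha_mono : MonotoneOn a (Set.Ici 1))
    (hb : ∀ j, 1 ≤ j → 0 < b j) {β : ℝ} (hβ : 0 < β) (hbβ : ∀ j, 1 ≤ j → β ≤ b j) {t : ℝ}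
    (ht : 0 < t) (h : Tendsto (fun j : ℕ => a j / Real.log j) atTop atTop) :
    STWT 2 t (sobolevEmbedding a b) := by
  obtain ⟨C, hC, hexp⟩ := exists_sum_exp_le_rpow hβ hbβ (p := 1) one_pos
  obtain ⟨C', hC', hexp'⟩ := exists_sum_exp_le_exp hβ hbβ
  have ha1 := ha 1 le_rfl
  refine stwt_of_forall_log_le two_pos ht _ fun η hη => ?_
  have hlog : Tendsto (fun d : ℕ => Real.log d) atTop atTop :=
    Real.tendsto_log_atTop.comp tendsto_natCast_atTop_atTop
  obtain ⟨j₀, hj₀⟩ := eventually_atTop.mp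
    ((h.eventually_ge_atTop (4 / η)).and (hlog.eventually_ge_atTop 1))
  refine ⟨j₀ * (C * (η * a 1)⁻¹) + C' * 3, fun d hd ε hε => ?_⟩
  have hb1 := log_infoComplexity_le ha hb (d := d) hε (l := η) hη.le
    (fun j => (if j < j₀ then C * (η * a 1)⁻¹ else 0) + C' * ((j : ℝ) ^ 2)⁻¹) fun j hj _ T => by
      have haj := ha j hj
      have hj0 : (0 : ℝ) < j := by exact_mod_cast hj
      have hpos : 0 < C' * ((j : ℝ) ^ 2)⁻¹ := by positivity
      split_ifs with hlt
      · refine (hexp j hj _ (by positivity) T).trans (Real.exp_le_exp.mpr ?_)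
        rw [Real.rpow_neg_one]
        have : C * (η * a j)⁻¹ ≤ C * (η * a 1)⁻¹ := by
          gcongr
          exact le_of_monotoneOn_Ici_one ha_mono hj
        linarith
      · obtain ⟨h1, h2⟩ := hj₀ j (not_lt.mp hlt)
        rw [div_le_div_iff₀ hη (by linarith)] at h1
        have h3 : 4 * Real.log j ≤ η * a j := by linarith
        refine (hexp' j hj _ (by linarith) T).trans (Real.exp_le_exp.mpr ?_)
        rw [zero_add]
        gcongr
        rw [← Real.exp_log hj0, ← Real.exp_nat_mul, ← Real.exp_neg]
        gcongr
        push_cast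
        linarith
  rw [Finset.sum_add_distrib, ← Finset.mul_sum] at hb1
  have h2 := sum_range_ite_lt_le d j₀ (K := C * (η * a 1)⁻¹) (by positivity)
  have h3 := mul_le_mul_of_nonneg_left (sum_range_inv_sq_le d) hC'.le
  push_cast at hb1
  rw [Real.rpow_two]
  have : 0 ≤ η * (d : ℝ) ^ t := by positivity
  linarith

/-- Take `l = ε²` and `p = s/4`. Eventually `a_j^(-p) ≤ j⁻²`, so the coordinates contribute
`O(ε^(-s/2))` independently of `d`, which is of lower order than `ε^(-s)`. -/
theorem uwt_of_tendsto (ha : ∀ j, 1 ≤ j → 0 < a j)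
    (ha_mono : MonotoneOn a (Set.Ici 1))
    (hb : ∀ j, 1 ≤ j → 0 < b j) {β : ℝ} (hβ : 0 < β) (hbβ : ∀ j, 1 ≤ j → β ≤ b j)
    (h : Tendsto (fun j : ℕ => Real.log (a j) / Real.log j) atTop atTop) :
    UWT (sobolevEmbedding a b) := by
  intro s t hs ht
  have ha1 := ha 1 le_rfl
  set p := s / 4 with hp
  have hp0 : 0 < p := by positivity
  obtain ⟨C, hC, hexp⟩ := exists_sum_exp_le_rpow hβ hbβ hp0
  obtain ⟨j₀, hj₀⟩ := eventually_atTop.mp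
    ((h.eventually_ge_atTop (2 / p)).and (eventually_ge_atTop 2))
  refine stwt_of_forall_log_le hs ht _ fun η hη => ?_
  set D := C * (j₀ * a 1 ^ (-p) + 3) with hD
  have hD0 : 0 < D := by positivity
  obtain ⟨K, hK⟩ := exists_rpow_le_mul_add (θ := 1 / 2) (η := η / D) (by norm_num) (by norm_num)
    (by positivity)
  refine ⟨1 + D * K, fun d hd ε hε => ?_⟩
  have hE : 0 < ε⁻¹ := inv_pos.mpr hε.1
  have hb1 := log_infoComplexity_le ha hb (d := d) hε (l := (ε⁻¹ ^ 2)⁻¹) (by positivity)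
    (fun j => C * ε⁻¹ ^ (2 * p) * ((if j < j₀ then a 1 ^ (-p) else 0) + ((j : ℝ) ^ 2)⁻¹))
    fun j hj _ T => by
      have haj := ha j hj
      have hj0 : (0 : ℝ) < j := by exact_mod_cast hj
      have hpos : 0 < ((j : ℝ) ^ 2)⁻¹ := by positivity
      refine (hexp j hj _ (by positivity) T).trans (Real.exp_le_exp.mpr ?_)
      have h1 : ((ε⁻¹ ^ 2)⁻¹ * a j) ^ (-p) = ε⁻¹ ^ (2 * p) * a j ^ (-p) := by
        rw [Real.mul_rpow (by positivity) haj.le, Real.rpow_neg (by positivity) p,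
          Real.inv_rpow (by positivity), inv_inv, Real.rpow_mul hE.le, Real.rpow_two]
      rw [h1, ← mul_assoc]
      gcongr ?_ * ?_
      split_ifs with hlt
      · have := Real.rpow_le_rpow_of_nonpos ha1 (le_of_monotoneOn_Ici_one ha_mono hj)
          (show -p ≤ 0 by linarith)
        linarith
      · obtain ⟨h1, h2⟩ := hj₀ j (not_lt.mp hlt)
        have hlogj : 0 < Real.log j := Real.log_pos (by exact_mod_cast h2)
        rw [div_le_div_iff₀ hp0 hlogj] at h1
        rw [zero_add, Real.rpow_neg haj.le]
        gcongr
        rw [← Real.rpow_natCast, Real.rpow_def_of_pos hj0, Real.rpow_def_of_pos haj]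
        refine Real.exp_le_exp.mpr ?_
        push_cast
        linarith
  rw [← Finset.mul_sum, Finset.sum_add_distrib, inv_mul_cancel₀ (by positivity)] at hb1
  have h2 := sum_range_ite_lt_le d j₀ (K := a 1 ^ (-p)) (by positivity)
  have h3 := sum_range_inv_sq_le d
  push_cast at hb1
  have h4 : ε⁻¹ ^ (2 * p) = (ε⁻¹ ^ s) ^ ((1 : ℝ) / 2) := by
    rw [← Real.rpow_mul hE.le]
    congr 1
    rw [hp]
    ring
  have h5 := hK (ε⁻¹ ^ s) (by positivity)
  calc _ ≤ _ := hb1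
    _ ≤ 1 + C * ε⁻¹ ^ (2 * p) * (j₀ * a 1 ^ (-p) + 3) := by gcongr
    _ = 1 + D * (ε⁻¹ ^ s) ^ ((1 : ℝ) / 2) := by
      rw [h4, hD]
      ring
    _ ≤ 1 + D * (η / D * ε⁻¹ ^ s + K) := by gcongr
    _ = η * ε⁻¹ ^ s + (1 + D * K) := by
      field_simp
      ring
    _ ≤ _ := by
      gcongr
      exact le_add_of_nonneg_right (by positivity)

/-- Put `X = ε^(-s)` and scale `l` so that `l ε⁻²` is a small multiple of `X`. Then `l a_j ≥ Q
(j/X)^γ` with `Q` as large as desired. The power bound with `p = 1/(2γ)` for `j ≤ X` and with `p =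
2/γ` for `j > X` gives terms `(X/j)^(1/2)` and `(X/j)²`, both summing to `O(X)` with a small factor.
-/
theorem stwt_of_tendsto_div_rpow (ha : ∀ j, 1 ≤ j → 0 < a j)
    (ha_mono : MonotoneOn a (Set.Ici 1))
    (hb : ∀ j, 1 ≤ j → 0 < b j) {β : ℝ} (hβ : 0 < β) (hbβ : ∀ j, 1 ≤ j → β ≤ b j) {s t : ℝ}
    (hs : 0 < s) (hs2 : s < 2) (ht : 0 < t)
    (h : Tendsto (fun j : ℕ => a j / (j : ℝ) ^ ((2 - s) / s)) atTop atTop) :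
    STWT s t (sobolevEmbedding a b) := by
  have ha1 := ha 1 le_rfl
  set γ := (2 - s) / s with hγ
  have hγ0 : 0 < γ := div_pos (by linarith) hs
  obtain ⟨C₁, hC₁, hexp₁⟩ := exists_sum_exp_le_rpow hβ hbβ (p := 1 / (2 * γ)) (by positivity)
  obtain ⟨C₂, hC₂, hexp₂⟩ := exists_sum_exp_le_rpow hβ hbβ (p := 2 / γ) (by positivity)
  refine stwt_of_forall_log_le hs ht _ fun η hη => ?_
  have hlim₁ : Tendsto (fun Q : ℝ => C₁ * Q ^ (-(1 / (2 * γ)))) atTop (𝓝 0) := by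
    simpa using (tendsto_rpow_neg_atTop (y := 1 / (2 * γ)) (by positivity)).const_mul C₁
  have hlim₂ : Tendsto (fun Q : ℝ => C₂ * Q ^ (-(2 / γ))) atTop (𝓝 0) := by
    simpa using (tendsto_rpow_neg_atTop (y := 2 / γ) (by positivity)).const_mul C₂
  obtain ⟨Q, hQ1, hQ2, hQ0⟩ := ((hlim₁.eventually_lt_const (show 0 < η / 8 by positivity)).and
    ((hlim₂.eventually_lt_const (show 0 < η / 8 by positivity)).and (eventually_gt_atTop 0))).exists
  -- Budget: `η/4` each for the linear term, the first `j₀` coordinates, the range `j ≤ X` and the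
  -- range `j > X`. Each of the last two is `η/8` times a sum bounded by `2X`.
  set τ := η / 4 with hτ
  have hτ0 : 0 < τ := by positivity
  obtain ⟨j₀, hj₀⟩ := eventually_atTop.mp (h.eventually_ge_atTop (Q / τ))
  set D := C₁ * (τ * a 1) ^ (-(1 / (2 * γ))) with hD
  have hD0 : 0 < D := by positivity
  obtain ⟨K, hK⟩ := exists_rpow_le_mul_add (θ := 1 / 2) (η := η / 4 / (j₀ * D + 1))
    (by norm_num) (by norm_num) (by positivity)
  refine ⟨(j₀ * D + 1) * K, fun d hd ε hε => ?_⟩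
  have hE : 0 < ε⁻¹ := inv_pos.mpr hε.1
  have hE1 : 1 ≤ ε⁻¹ := (one_le_inv₀ hε.1).mpr hε.2.le
  set X := ε⁻¹ ^ s with hX
  have hX1 : 1 ≤ X := Real.one_le_rpow hE1 hs.le
  have hX0 : 0 < X := by linarith
  -- Since `ε⁻² = X^(2/s) = X^(1+γ)`, this yields `l ε⁻² = τ X`.
  set l := τ * X ^ (-γ) with hl
  have hlE : l * ε⁻¹ ^ 2 = τ * X := by
    rw [hl, hX, ← Real.rpow_two, ← Real.rpow_mul hE.le, mul_assoc, ← Real.rpow_add hE, hγ]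
    congr 2
    field_simp
    ring
  have hscale : ∀ j, 1 ≤ j → j₀ ≤ j → Q * ((j : ℝ) / X) ^ γ ≤ l * a j := fun j hj hjj => by
    have hj0 : (0 : ℝ) < j := by exact_mod_cast hj
    have h1 := hj₀ j hjj
    rw [div_le_div_iff₀ hτ0 (by positivity)] at h1
    rw [Real.div_rpow hj0.le hX0.le, hl, Real.rpow_neg hX0.le, mul_div_assoc', div_le_iff₀
      (by positivity)]
    field_simp
    linarith
  have hb1 := log_infoComplexity_le ha hb (d := d) hε (l := l) (by positivity)
    (fun j => (if j < j₀ then D * X ^ ((1 : ℝ) / 2) else 0) +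
      (η / 8 * (if (j : ℝ) ≤ X then √X * (√(j : ℝ))⁻¹ else 0) +
        η / 8 * (if (j : ℝ) ≤ X then 0 else X ^ 2 * ((j : ℝ) ^ 2)⁻¹))) fun j hj _ T => by
      have haj := ha j hj
      have hj0 : (0 : ℝ) < j := by exact_mod_cast hj
      by_cases hlt : j < j₀
      · refine (hexp₁ j hj _ (by positivity) T).trans (Real.exp_le_exp.mpr ?_)
        rw [if_pos hlt]
        have h1 : C₁ * (l * a j) ^ (-(1 / (2 * γ))) ≤ D * X ^ ((1 : ℝ) / 2) := by
          have h2 : (l * a 1) ^ (-(1 / (2 * γ))) =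
              (τ * a 1) ^ (-(1 / (2 * γ))) * X ^ ((1 : ℝ) / 2) := by
            rw [hl, mul_right_comm, Real.mul_rpow (by positivity) (by positivity),
              ← Real.rpow_mul hX0.le]
            congr 2
            field_simp
          have h3 : D * X ^ ((1 : ℝ) / 2) = C₁ * (l * a 1) ^ (-(1 / (2 * γ))) := by
            rw [h2, ← mul_assoc]
          rw [h3]
          refine mul_le_mul_of_nonneg_left ?_ hC₁.le
          refine Real.rpow_le_rpow_of_nonpos (by positivity) ?_
            (neg_nonpos.mpr (by positivity))
          gcongr
          exact le_of_monotoneOn_Ici_one ha_mono hj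
        refine h1.trans (le_add_of_nonneg_right (add_nonneg ?_ ?_))
        · split_ifs <;> positivity
        · split_ifs <;> positivity
      · have h1 := hscale j hj (not_lt.mp hlt)
        have hpos : 0 < Q * ((j : ℝ) / X) ^ γ := by positivity
        rw [if_neg hlt, zero_add]
        split_ifs with hjX
        · refine (hexp₁ j hj _ (by positivity) T).trans (Real.exp_le_exp.mpr ?_)
          have h2 := Real.rpow_le_rpow_of_nonpos hpos h1
            (z := -(1 / (2 * γ))) (neg_nonpos.mpr (by positivity))
          have h3 : (Q * ((j : ℝ) / X) ^ γ) ^ (-(1 / (2 * γ))) =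
              Q ^ (-(1 / (2 * γ))) * (√X * (√(j : ℝ))⁻¹) := by
            rw [Real.mul_rpow hQ0.le (by positivity), ← Real.rpow_mul (by positivity),
              show γ * -(1 / (2 * γ)) = -(1 / 2) by field_simp, Real.rpow_neg (show 0 ≤ (j : ℝ) / X by positivity),
              ← Real.sqrt_eq_rpow, Real.sqrt_div hj0.le, inv_div, ← div_eq_mul_inv]
          rw [h3] at h2
          calc _ ≤ C₁ * (Q ^ (-(1 / (2 * γ))) * (√X * (√(j : ℝ))⁻¹)) := by gcongr
            _ = C₁ * Q ^ (-(1 / (2 * γ))) * (√X * (√(j : ℝ))⁻¹) := by ring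
            _ ≤ η / 8 * (√X * (√(j : ℝ))⁻¹) := by gcongr
            _ = _ := by ring
        · refine (hexp₂ j hj _ (by positivity) T).trans (Real.exp_le_exp.mpr ?_)
          have h2 := Real.rpow_le_rpow_of_nonpos hpos h1
            (z := -(2 / γ)) (neg_nonpos.mpr (by positivity))
          have h3 : (Q * ((j : ℝ) / X) ^ γ) ^ (-(2 / γ)) =
              Q ^ (-(2 / γ)) * (X ^ 2 * ((j : ℝ) ^ 2)⁻¹) := by
            rw [Real.mul_rpow hQ0.le (by positivity), ← Real.rpow_mul (by positivity),
              show γ * -(2 / γ) = -2 by field_simp, Real.rpow_neg (show 0 ≤ (j : ℝ) / X by positivity),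
              Real.rpow_two, div_pow, inv_div, ← div_eq_mul_inv]
          rw [h3] at h2
          calc _ ≤ C₂ * (Q ^ (-(2 / γ)) * (X ^ 2 * ((j : ℝ) ^ 2)⁻¹)) := by gcongr
            _ = C₂ * Q ^ (-(2 / γ)) * (X ^ 2 * ((j : ℝ) ^ 2)⁻¹) := by ring
            _ ≤ η / 8 * (X ^ 2 * ((j : ℝ) ^ 2)⁻¹) := by gcongr
            _ = _ := by ring
  rw [hlE, Finset.sum_add_distrib, Finset.sum_add_distrib, ← Finset.mul_sum,
    ← Finset.mul_sum] at hb1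
  push_cast at hb1
  have h1 := sum_range_ite_lt_le d j₀ (K := D * X ^ ((1 : ℝ) / 2)) (by positivity)
  have h2 := mul_le_mul_of_nonneg_left (sum_ite_le_sqrt hX1 d) (show 0 ≤ η / 8 by positivity)
  have h3 := mul_le_mul_of_nonneg_left (sum_ite_le_sq hX1 d) (show 0 ≤ η / 8 by positivity)
  have h4 : j₀ * (D * X ^ ((1 : ℝ) / 2)) ≤ η / 4 * X + (j₀ * D + 1) * K := by
    calc j₀ * (D * X ^ ((1 : ℝ) / 2)) = (j₀ * D) * X ^ ((1 : ℝ) / 2) := by ring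
      _ ≤ (j₀ * D + 1) * X ^ ((1 : ℝ) / 2) := by
        gcongr
        linarith
      _ ≤ (j₀ * D + 1) * (η / 4 / (j₀ * D + 1) * X + K) := by
        gcongr
        exact hK X hX0.le
      _ = _ := by
        field_simp
  have h5 : 0 ≤ η * (d : ℝ) ^ t := by positivity
  have h6 : τ * X = η / 4 * X := rfl
  linarith

end Sufficiency

/-! ### Limits inferior and logarithmic growth -/

theorem lt_liminf_coe_iff (u : ℕ → ℝ) :
    0 < liminf (fun j : ℕ => ((u j : ℝ) : EReal)) atTop ↔
      ∃ δ : ℝ, 0 < δ ∧ ∀ᶠ j in atTop, δ ≤ u j := by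
  constructor
  · intro h
    obtain ⟨δ, h0, hδ⟩ := EReal.lt_iff_exists_real_btwn.mp h
    refine ⟨δ, by exact_mod_cast h0, (eventually_lt_of_lt_liminf hδ).mono fun j hj => ?_⟩
    exact (EReal.coe_lt_coe_iff.mp hj).le
  · rintro ⟨δ, h0, h⟩
    -- In `EReal` boundedness is automatic, so ratios tending to infinity are covered with liminf
    -- `⊤`.
    refine lt_of_lt_of_le (EReal.coe_pos.mpr h0) (le_liminf_of_le (by isBoundedDefault) ?_)
    exact h.mono fun j hj => EReal.coe_le_coe_iff.mpr hj

theorem exists_forall_le_add_of_eventually_le {u v : ℕ → ℝ} (h : ∀ᶠ j in atTop, u j ≤ v j) :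
    ∃ K : ℝ, 0 ≤ K ∧ ∀ j, u j ≤ v j + K := by
  obtain ⟨n, hn⟩ := eventually_atTop.mp h
  refine ⟨∑ j ∈ Finset.range n, |u j - v j|, Finset.sum_nonneg fun _ _ => abs_nonneg _,
    fun j => ?_⟩
  rcases le_or_gt n j with hj | hj
  · linarith [hn j hj, Finset.sum_nonneg fun j (_ : j ∈ Finset.range n) => abs_nonneg (u j - v j)]
  · linarith [le_abs_self (u j - v j), Finset.single_le_sum
      (f := fun j => |u j - v j|) (fun j _ => abs_nonneg _) (Finset.mem_range.mpr hj)]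

theorem sum_range_ite_le_le (d : ℕ) {Y K : ℝ} (hY : 0 ≤ Y) (hK : 0 ≤ K) :
    ∑ j ∈ Finset.range d, (if (j : ℝ) + 1 ≤ Y then K else 0) ≤ Y * K := by
  rw [← Finset.sum_filter, Finset.sum_const, nsmul_eq_mul]
  gcongr
  refine le_trans ?_ (Nat.floor_le hY)
  refine Nat.cast_le.mpr ((Finset.card_le_card (t := Finset.range ⌊Y⌋₊) fun j hj => ?_).trans_eq
    (Finset.card_range _))
  rw [Finset.mem_filter] at hj
  rw [Finset.mem_range, Nat.lt_iff_add_one_le]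
  exact Nat.le_floor (by exact_mod_cast hj.2)

theorem eventually_mul_one_add_log_sq_le (C : ℝ) :
    ∀ᶠ d : ℕ in atTop, C * (1 + Real.log d) ^ 2 ≤ Real.log 2 / 2 * d := by
  have hlog2 : 0 < Real.log 2 := Real.log_pos one_lt_two
  set c := Real.log 2 / (8 * (|C| + 1)) with hc
  have hc0 : 0 < c := by positivity
  have h1 := (Real.isLittleO_pow_log_id_atTop (n := 2)).bound hc0
  have h2 := tendsto_natCast_atTop_atTop (R := ℝ) |>.eventually h1
  have h3 := (tendsto_natCast_atTop_atTop (R := ℝ)).eventually_ge_atTop (1 / c)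
  filter_upwards [h2, h3] with d hd hd1
  simp only [id, Real.norm_eq_abs, abs_pow, sq_abs, Nat.abs_cast] at hd
  rw [div_le_iff₀ hc0] at hd1
  have h4 : (1 + Real.log d) ^ 2 ≤ 4 * c * d := by nlinarith [sq_nonneg (1 - Real.log d)]
  have h5 : 4 * c * (|C| + 1) = Real.log 2 / 2 := by
    rw [hc]
    field_simp
    norm_num
  calc C * (1 + Real.log d) ^ 2 ≤ (|C| + 1) * (4 * c * d) := by
        gcongr
        linarith [le_abs_self C]
    _ = 4 * c * (|C| + 1) * d := by ring
    _ = _ := by rw [h5]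

/-! ### Common estimates for polynomial and quasi-polynomial tractability -/

section Polynomial

variable {a b : ℕ → ℝ}

/-- Serves both notions, with `w = 1` or `w = 1 + ln d`. In the box bound only coordinates with `a_j
< ε⁻²` are active: their number gives the `ln 3` part, and `∑ 1/b_j ≤ B w` gives the part
proportional to `ln ε⁻¹`. -/
theorem exists_log_infoComplexity_le_mul (ha : ∀ j, 1 ≤ j → 0 < a j)
    (ha_mono : MonotoneOn a (Set.Ici 1)) (hb : ∀ j, 1 ≤ j → 0 < b j) {B K : ℝ} (hB : 0 ≤ B)
    (hK : 0 ≤ K) : ∃ t : ℝ, 0 < t ∧ ∀ d : ℕ, ∀ w : ℝ, 0 ≤ w →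
      ∑ j ∈ Finset.range d, (b (j + 1))⁻¹ ≤ B * w → ∀ ε ∈ Set.Ioo (0 : ℝ) 1,
      (∀ j, 1 ≤ j → j ≤ d → a j < ε⁻¹ ^ 2 → j ≤ K * w * (1 + Real.log ε⁻¹)) →
      Real.log (infoComplexity (sobolevEmbedding a b d) ε) ≤ t * w * (1 + Real.log ε⁻¹) := by
  refine ⟨K * Real.log 3 + B * (2 + |Real.log (a 1)|) + 1, by positivity,
    fun d w hw hsum ε hε hcount => ?_⟩
  have hE1 : 1 < ε⁻¹ := (one_lt_inv₀ hε.1).mpr hε.2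
  have hE : 0 < ε⁻¹ := by linarith
  have hinv : 1 < ε⁻¹ ^ 2 := one_lt_pow₀ hE1 two_ne_zero
  have hl : 0 < Real.log ε⁻¹ := Real.log_pos hE1
  set l := Real.log ε⁻¹ with hldef
  have ha1 := ha 1 le_rfl
  set Y := K * w * (1 + l) with hY
  have hY0 : 0 ≤ Y := by positivity
  have h := log_ncard_freqSet_le_sum ha hb (d := d) (x := ε⁻¹ ^ 2 - 1) (by linarith)
  rw [infoComplexity_sobolevEmbedding ha hb d hε]
  rw [Fin.sum_univ_eq_sum_range (fun j => if ε⁻¹ ^ 2 - 1 ≤ a (j + 1) then 0 else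
    Real.log 3 + (2 * b (j + 1))⁻¹ * Real.log ((ε⁻¹ ^ 2 - 1) / a (j + 1)))] at h
  have hlog3 : 0 < Real.log 3 := Real.log_pos (by norm_num)
  set L := 2 * l + |Real.log (a 1)| with hL
  have hL0 : 0 ≤ L := by positivity
  have h2 : ∑ j ∈ Finset.range d, (if ε⁻¹ ^ 2 - 1 ≤ a (j + 1) then 0 else
      Real.log 3 + (2 * b (j + 1))⁻¹ * Real.log ((ε⁻¹ ^ 2 - 1) / a (j + 1))) ≤
      ∑ j ∈ Finset.range d, ((if (j : ℝ) + 1 ≤ Y then Real.log 3 else 0) +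
        (b (j + 1))⁻¹ * L) := by
    refine Finset.sum_le_sum fun j hj => ?_
    have hb1 := hb (j + 1) (Nat.le_add_left 1 _)
    have ha2 := ha (j + 1) (Nat.le_add_left 1 _)
    have h0 : 0 ≤ (b (j + 1))⁻¹ * L := by positivity
    by_cases hlt : ε⁻¹ ^ 2 - 1 ≤ a (j + 1)
    · rw [if_pos hlt]
      refine add_nonneg ?_ h0
      split_ifs <;> positivity
    · rw [if_neg hlt]
      have hlt' := not_le.mp hlt
      have h3 := hcount (j + 1) (Nat.le_add_left 1 _) (Finset.mem_range.mp hj) (by linarith)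
      push_cast at h3
      rw [if_pos h3]
      have h4 : Real.log ((ε⁻¹ ^ 2 - 1) / a (j + 1)) ≤ Real.log (ε⁻¹ ^ 2 / a 1) := by
        refine Real.log_le_log (div_pos (by linarith) ha2) ?_
        gcongr
        · linarith
        · exact le_of_monotoneOn_Ici_one ha_mono (Nat.le_add_left 1 _)
      rw [Real.log_div (by positivity) ha1.ne', Real.log_pow] at h4
      push_cast at h4
      have h5 : (2 * b (j + 1))⁻¹ ≤ (b (j + 1))⁻¹ := by
        gcongr
        linarith
      refine add_le_add le_rfl (mul_le_mul h5 ?_ (Real.log_nonneg ?_) (by positivity))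
      · linarith [neg_abs_le (Real.log (a 1))]
      · exact (one_le_div₀ ha2).mpr hlt'.le
  rw [Finset.sum_add_distrib, ← Finset.sum_mul] at h2
  have h3 := sum_range_ite_le_le d hY0 hlog3.le
  have h4 := mul_le_mul_of_nonneg_right hsum hL0
  have h5 : B * w * L ≤ B * w * ((2 + |Real.log (a 1)|) * (1 + l)) := by
    gcongr
    nlinarith [abs_nonneg (Real.log (a 1))]
  have h6 : 0 ≤ w * (1 + l) := by positivity
  calc _ ≤ Y * Real.log 3 + B * w * ((2 + |Real.log (a 1)|) * (1 + l)) := by linarith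
    _ ≤ _ := by
      rw [hY]
      nlinarith

/-- For fixed `d` the inscribed box has about `ε^(-∑ 1/b_j)` points. Letting `ε → 0` compares the
coefficients of `ln ε⁻¹`; everything depending on `d` alone drops out. -/
theorem sum_inv_le_of_log_infoComplexity_le (ha : ∀ j, 1 ≤ j → 0 < a j)
    (hb : ∀ j, 1 ≤ j → 0 < b j) {d : ℕ} (hd : 1 ≤ d) {A T : ℝ}
    (h : ∀ ε ∈ Set.Ioo (0 : ℝ) 1,
      Real.log (infoComplexity (sobolevEmbedding a b d) ε) ≤ A + T * Real.log ε⁻¹) :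
    ∑ j ∈ Finset.range d, (b (j + 1))⁻¹ ≤ T := by
  have hd0 : (0 : ℝ) < d := by exact_mod_cast hd
  set P := ∑ j : Fin d, (2 * b (j + 1))⁻¹ with hP
  set c := ∑ j : Fin d, (2 * b (j + 1))⁻¹ * Real.log (d * a (j + 1)) with hc
  have hP0 : 0 ≤ P := Finset.sum_nonneg fun j _ => by
    have := hb (j + 1) (Nat.le_add_left 1 _)
    positivity
  have hsum : ∑ j ∈ Finset.range d, (b (j + 1))⁻¹ = 2 * P := by
    rw [← Fin.sum_univ_eq_sum_range (fun j => (b (j + 1))⁻¹), hP, Finset.mul_sum]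
    refine Finset.sum_congr rfl fun j _ => ?_
    rw [mul_inv]
    ring
  rw [hsum]
  by_contra! hlt
  -- With `ε = exp(-l)`, a positive slope `2P - T` would make the left side unbounded in `l`.
  have key : ∀ l : ℝ, 1 ≤ l → (2 * P - T) * l ≤ A + c + P * Real.log 2 := by
    intro l hl
    have hε : Real.exp (-l) ∈ Set.Ioo (0 : ℝ) 1 :=
      ⟨Real.exp_pos _, by
        rw [← Real.exp_zero]
        exact Real.exp_lt_exp.mpr (by linarith)⟩
    have h1 := h _ hε
    have hinv : (Real.exp (-l))⁻¹ = Real.exp l := by rw [Real.exp_neg, inv_inv]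
    rw [infoComplexity_sobolevEmbedding ha hb d hε, hinv, Real.log_exp] at h1
    have hE : 2 ≤ Real.exp l := by linarith [Real.add_one_le_exp l]
    set x := Real.exp l ^ 2 - 1 with hx
    have hx2 : Real.exp l ^ 2 / 2 ≤ x := by nlinarith
    have hx0 : 0 < x := by nlinarith
    have hlogx : 2 * l - Real.log 2 ≤ Real.log x := by
      have := Real.log_le_log (by positivity) hx2
      rw [Real.log_div (by positivity) two_ne_zero, Real.log_pow, Real.log_exp] at this
      exact_mod_cast this
    have h2 := Real.log_le_log (Finset.prod_pos fun j _ => by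
      have := ha (j + 1) (Nat.le_add_left 1 _)
      positivity) (prod_rpow_le_ncard_freqSet ha hb hd hx0)
    rw [Real.log_prod fun j _ => by
      have := ha (j + 1) (Nat.le_add_left 1 _)
      positivity] at h2
    have h3 : ∑ j : Fin d, Real.log ((x / (d * a (j + 1))) ^ (2 * b (j + 1))⁻¹) =
        P * Real.log x - c := by
      rw [hP, hc, Finset.sum_mul, ← Finset.sum_sub_distrib]
      refine Finset.sum_congr rfl fun j _ => ?_
      have := ha (j + 1) (Nat.le_add_left 1 _)
      rw [Real.log_rpow (by positivity), Real.log_div (by positivity) (by positivity), mul_sub]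
    rw [h3] at h2
    nlinarith
  have hpos : 0 < 2 * P - T := by linarith
  have h1 := key (max 1 ((A + c + P * Real.log 2 + 1) / (2 * P - T))) (le_max_left _ _)
  have h2 := mul_le_mul_of_nonneg_left
    (le_max_right 1 ((A + c + P * Real.log 2 + 1) / (2 * P - T))) hpos.le
  rw [mul_div_cancel₀ _ hpos.ne'] at h2
  linarith

/-- Terms logarithmic in `d`, even after multiplication by `w`, are `o(d)`. So half of `d ln 2` has
to come from `p w ln a_d`, whence `δ = ln 2 / (2p)`. -/
theorem eventually_le_mul_log_div (ha : ∀ j, 1 ≤ j → 0 < a j) {w : ℕ → ℝ}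
    (hw1 : ∀ d, 1 ≤ d → 1 ≤ w d) (hw2 : ∀ d, 1 ≤ d → w d ≤ 1 + Real.log d) {C p : ℝ}
    (hC : 0 ≤ C) (hp : 0 < p)
    (h : ∀ d, 1 ≤ d → d * Real.log 2 ≤
      w d * (C * (1 + Real.log d) + p * Real.log (1 + 2 * d * a d))) :
    ∃ δ : ℝ, 0 < δ ∧ ∀ᶠ d in atTop, δ ≤ w d * Real.log (a d) / d := by
  have hlog2 : 0 < Real.log 2 := Real.log_pos one_lt_two
  have hlog3 : 0 < Real.log 3 := Real.log_pos (by norm_num)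
  refine ⟨Real.log 2 / (2 * p), by positivity, ?_⟩
  filter_upwards [eventually_mul_one_add_log_sq_le (C + p * (1 + Real.log 3)),
    eventually_ge_atTop 1] with d hlog hd
  have hd1 : (1 : ℝ) ≤ d := by exact_mod_cast hd
  have hd0 : (0 : ℝ) < d := by linarith
  have had := ha d hd
  have hld : 0 ≤ Real.log d := Real.log_nonneg hd1
  have hw := hw1 d hd
  have h1 : Real.log (1 + 2 * d * a d) ≤ Real.log 3 + Real.log d + max 0 (Real.log (a d)) := by
    rcases le_total (a d) 1 with h | h
    · have h2 : 1 + 2 * d * a d ≤ 3 * d := by nlinarith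
      have h3 := Real.log_le_log (by positivity) h2
      rw [Real.log_mul (by norm_num) hd0.ne'] at h3
      linarith [le_max_left 0 (Real.log (a d))]
    · have h2 : 1 + 2 * d * a d ≤ 3 * d * a d := by nlinarith
      have h3 := Real.log_le_log (by positivity) h2
      rw [Real.log_mul (by positivity) had.ne', Real.log_mul (by norm_num) hd0.ne'] at h3
      linarith [le_max_right 0 (Real.log (a d))]
  set M := max 0 (Real.log (a d)) with hM
  have h2 : d * Real.log 2 ≤
      w d * ((C + p * (1 + Real.log 3)) * (1 + Real.log d)) + w d * (p * M) := by
    refine (h d hd).trans ?_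
    rw [← mul_add]
    refine mul_le_mul_of_nonneg_left ?_ (by linarith)
    have : p * Real.log (1 + 2 * d * a d) ≤ p * (Real.log 3 + Real.log d + M) := by gcongr
    nlinarith [mul_nonneg (mul_nonneg hp.le hlog3.le) hld]
  have h3 : w d * ((C + p * (1 + Real.log 3)) * (1 + Real.log d)) ≤
      (C + p * (1 + Real.log 3)) * (1 + Real.log d) ^ 2 := by
    calc _ ≤ (1 + Real.log d) * ((C + p * (1 + Real.log 3)) * (1 + Real.log d)) := by
          gcongr
          exact hw2 d hd
      _ = _ := by ring
  have h4 : Real.log 2 / 2 * d ≤ w d * (p * M) := by linarith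
  -- The truncation at zero covers `a d < 1`; positivity of `M` shows that it is inactive for large
  -- `d`.
  have hM0 : 0 < M := by
    have : 0 < w d * (p * M) := lt_of_lt_of_le (by positivity) h4
    exact pos_of_mul_pos_right (pos_of_mul_pos_right this (by linarith)) hp.le
  have hMeq : M = Real.log (a d) := by
    rcases max_choice 0 (Real.log (a d)) with h | h
    · rw [hM, h] at hM0
      exact absurd hM0 (lt_irrefl _)
    · exact h
  rw [div_le_div_iff₀ (by positivity) hd0, ← hMeq]
  linarith

end Polynomial

/-! ### Criteria for SPT, PT and QPT -/

section PolynomialTractability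

variable {a b : ℕ → ℝ}

theorem one_le_infoComplexity (ha : ∀ j, 1 ≤ j → 0 < a j) (hb : ∀ j, 1 ≤ j → 0 < b j)
    (d : ℕ) {ε : ℝ} (hε : ε ∈ Set.Ioo (0 : ℝ) 1) :
    (1 : ℝ) ≤ infoComplexity (sobolevEmbedding a b d) ε := by
  have hinv : 1 < ε⁻¹ ^ 2 := one_lt_pow₀ ((one_lt_inv₀ hε.1).mpr hε.2) two_ne_zero
  rw [infoComplexity_sobolevEmbedding ha hb d hε]
  exact_mod_cast one_le_ncard_freqSet ha hb (d := d) (by linarith)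

theorem sum_range_succ_eq_sum_Icc (f : ℕ → ℝ) (d : ℕ) :
    ∑ j ∈ Finset.range d, f (j + 1) = ∑ j ∈ Finset.Icc 1 d, f j := by
  induction d with
  | zero => simp
  | succ d ih => rw [Finset.sum_range_succ, Finset.sum_Icc_succ_top (by omega), ih]

theorem two_mul_natCast_mul_pos (ha : ∀ j, 1 ≤ j → 0 < a j) {d : ℕ} (hd : 1 ≤ d) :
    0 < 2 * (d : ℝ) * a d := by
  have := ha d hd
  have hd0 : (0 : ℝ) < d := by exact_mod_cast hd
  positivity

theorem SPT.pt {H G : ℕ → Type*} [∀ d, NormedAddCommGroup (H d)] [∀ d, NormedSpace ℂ (H d)]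
    [∀ d, NormedAddCommGroup (G d)] [∀ d, NormedSpace ℂ (G d)] {S : ∀ d, H d →L[ℂ] G d}
    (h : SPT S) : PT S := by
  obtain ⟨C, p, hC, hp, h⟩ := h
  refine ⟨C, p, 0, hC, hp, le_rfl, fun d hd ε hε => ?_⟩
  rw [Real.rpow_zero, mul_one]
  exact h d hd ε hε

theorem PT.summable_and_eventually_le (ha : ∀ j, 1 ≤ j → 0 < a j)
    (ha_mono : MonotoneOn a (Set.Ici 1)) (hb : ∀ j, 1 ≤ j → 0 < b j)
    (h : PT (sobolevEmbedding a b)) :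
    Summable (fun j : ℕ => (b (j + 1))⁻¹) ∧
      ∃ δ : ℝ, 0 < δ ∧ ∀ᶠ j : ℕ in atTop, δ ≤ Real.log (a j) / j := by
  obtain ⟨C, p, q, hC, hp, hq, h⟩ := h
  have hlog : ∀ d : ℕ, 1 ≤ d → ∀ ε ∈ Set.Ioo (0 : ℝ) 1,
      Real.log (infoComplexity (sobolevEmbedding a b d) ε) ≤
        (Real.log C + q * Real.log d) + p * Real.log ε⁻¹ := fun d hd ε hε => by
    have h1 := one_le_infoComplexity ha hb d hε
    have h2 := h d hd ε hε
    have hd0 : (0 : ℝ) < d := by exact_mod_cast hd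
    have hE : 0 < ε⁻¹ := inv_pos.mpr hε.1
    have hC0 : 0 < C := hC.lt_of_ne' fun h0 => by
      rw [h0, zero_mul, zero_mul] at h2
      linarith
    refine (Real.log_le_log (by linarith) h2).trans_eq ?_
    rw [Real.log_mul (by positivity) (by positivity), Real.log_mul (by positivity)
      (by positivity), Real.log_rpow hd0, Real.log_rpow hE]
  constructor
  · refine summable_of_sum_range_le (c := p) (fun j => ?_) fun d => ?_
    · have := hb (j + 1) (Nat.le_add_left 1 _)
      positivity
    · rcases Nat.eq_zero_or_pos d with rfl | hd
      · simpa using hp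
      · exact sum_inv_le_of_log_infoComplexity_le ha hb hd (hlog d hd)
  -- `p + 1` replaces `p`, which may be zero.
  · obtain ⟨δ, hδ, hev⟩ := eventually_le_mul_log_div (w := fun _ => 1) (C := |Real.log C| + q)
      (p := p + 1) ha (fun _ _ => le_rfl) (fun d hd => by
        linarith [Real.log_nonneg (show (1 : ℝ) ≤ d by exact_mod_cast hd)]) (by positivity)
      (by positivity) fun d hd => by
        have hy := two_mul_natCast_mul_pos ha hd
        have h1 := (mul_log_two_le_log_infoComplexity ha ha_mono hb hd).trans
          (hlog d hd _ (inv_sqrt_one_add_mem_Ioo hy))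
        rw [inv_inv, Real.log_sqrt (by positivity)] at h1
        have hl1 : 0 ≤ Real.log d := Real.log_nonneg (by exact_mod_cast hd)
        have hl2 : 0 ≤ Real.log (1 + 2 * d * a d) := Real.log_nonneg (by linarith)
        nlinarith [le_abs_self (Real.log C), mul_nonneg (abs_nonneg (Real.log C)) hl1,
          mul_nonneg hp hl2]
    simp only [one_mul] at hev
    exact ⟨δ, hδ, hev⟩

theorem spt_of_summable (ha : ∀ j, 1 ≤ j → 0 < a j) (ha_mono : MonotoneOn a (Set.Ici 1))
    (hb : ∀ j, 1 ≤ j → 0 < b j) (hsum : Summable (fun j : ℕ => (b (j + 1))⁻¹)) {δ : ℝ}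
    (hδ : 0 < δ) (hev : ∀ᶠ j : ℕ in atTop, δ ≤ Real.log (a j) / j) :
    SPT (sobolevEmbedding a b) := by
  obtain ⟨K, hK, hlog⟩ := exists_forall_le_add_of_eventually_le
    (u := fun j : ℕ => δ * j) (v := fun j => Real.log (a j)) (by
      filter_upwards [hev, eventually_gt_atTop 0] with j hj hj0
      exact (le_div_iff₀ (by exact_mod_cast hj0)).mp hj)
  have hbn : ∀ j : ℕ, 0 ≤ (b (j + 1))⁻¹ := fun j =>
    (inv_pos.mpr (hb (j + 1) (Nat.le_add_left 1 _))).le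
  obtain ⟨t, ht, hmain⟩ := exists_log_infoComplexity_le_mul ha ha_mono hb (tsum_nonneg hbn)
    (show 0 ≤ (2 + K) / δ by positivity)
  refine ⟨Real.exp t, t, (Real.exp_pos t).le, ht.le, fun d hd ε hε => ?_⟩
  have hE1 : 1 < ε⁻¹ := (one_lt_inv₀ hε.1).mpr hε.2
  have hl : 0 < Real.log ε⁻¹ := Real.log_pos hE1
  have h1 := hmain d 1 zero_le_one (by
    rw [mul_one]
    -- An active coordinate has `δ j ≤ ln a_j + K < 2 ln ε⁻¹ + K`, hence the constant `(2 + K)/δ`.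
    exact hsum.sum_le_tsum _ fun j _ => hbn j) ε hε fun j hj _ hlt => by
      have h2 := Real.log_lt_log (ha j hj) hlt
      rw [Real.log_pow] at h2
      push_cast at h2
      have h3 := hlog j
      rw [mul_one, div_mul_eq_mul_div, le_div_iff₀ hδ]
      nlinarith
  rw [Real.log_le_iff_le_exp (by linarith [one_le_infoComplexity ha hb d hε]), mul_one] at h1
  refine h1.trans_eq ?_
  rw [Real.rpow_def_of_pos (by linarith), ← Real.exp_add]
  ring_nf

theorem QPT.bddAbove_and_eventually_le (ha : ∀ j, 1 ≤ j → 0 < a j)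
    (ha_mono : MonotoneOn a (Set.Ici 1)) (hb : ∀ j, 1 ≤ j → 0 < b j)
    (h : QPT (sobolevEmbedding a b)) :
    BddAbove ((fun d : ℕ => (∑ j ∈ Finset.Icc 1 d, (b j)⁻¹) / (1 + Real.log d)) '' Set.Ici 1) ∧
      ∃ δ : ℝ, 0 < δ ∧ ∀ᶠ j : ℕ in atTop, δ ≤ (1 + Real.log j) * Real.log (a j) / j := by
  obtain ⟨C, t, hC, ht, h⟩ := h
  have hlog : ∀ d : ℕ, 1 ≤ d → ∀ ε ∈ Set.Ioo (0 : ℝ) 1,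
      Real.log (infoComplexity (sobolevEmbedding a b d) ε) ≤
        (Real.log C + t * (1 + Real.log d)) + t * (1 + Real.log d) * Real.log ε⁻¹ :=
    fun d hd ε hε => by
      have h1 := one_le_infoComplexity ha hb d hε
      refine (Real.log_le_log (by linarith) (h d hd ε hε)).trans_eq ?_
      rw [Real.log_mul hC.ne' (Real.exp_pos _).ne', Real.log_exp]
      ring
  constructor
  · refine ⟨t, ?_⟩
    rintro _ ⟨d, hd, rfl⟩
    have hd' : 1 ≤ d := hd
    have hl1 : 0 ≤ Real.log d := Real.log_nonneg (by exact_mod_cast hd')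
    simp only
    rw [div_le_iff₀ (by linarith), ← sum_range_succ_eq_sum_Icc (fun j => (b j)⁻¹)]
    exact sum_inv_le_of_log_infoComplexity_le ha hb hd' (hlog d hd')
  · refine eventually_le_mul_log_div (w := fun d => 1 + Real.log d) (C := |Real.log C| + t)
      (p := t) ha (fun d hd => by
        linarith [Real.log_nonneg (show (1 : ℝ) ≤ d by exact_mod_cast hd)])
      (fun d hd => le_rfl) (by positivity) ht fun d hd => by
        have hy := two_mul_natCast_mul_pos ha hd
        have h1 := (mul_log_two_le_log_infoComplexity ha ha_mono hb hd).trans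
          (hlog d hd _ (inv_sqrt_one_add_mem_Ioo hy))
        rw [inv_inv, Real.log_sqrt (by positivity)] at h1
        have hl1 : 0 ≤ Real.log d := Real.log_nonneg (by exact_mod_cast hd)
        have hl2 : 0 ≤ Real.log (1 + 2 * d * a d) := Real.log_nonneg (by linarith)
        set w := 1 + Real.log d with hw
        have hw1 : 1 ≤ w := by linarith
        refine h1.trans ?_
        have h2 : Real.log C ≤ w * (|Real.log C| * w) := by
          nlinarith [le_abs_self (Real.log C), abs_nonneg (Real.log C), mul_nonneg
            (abs_nonneg (Real.log C)) (show 0 ≤ w * w - 1 by nlinarith)]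
        have h3 : t * w ≤ w * (t * w) := by
          nlinarith [mul_nonneg ht.le (show 0 ≤ w * w - w by nlinarith)]
        have h4 : t * w * (Real.log (1 + 2 * d * a d) / 2) ≤
            w * (t * Real.log (1 + 2 * d * a d)) := by
          have : 0 ≤ w * (t * Real.log (1 + 2 * d * a d)) := by positivity
          linarith
        linarith

theorem qpt_of_bddAbove (ha : ∀ j, 1 ≤ j → 0 < a j) (ha_mono : MonotoneOn a (Set.Ici 1))
    (hb : ∀ j, 1 ≤ j → 0 < b j)
    (hsum : BddAbove ((fun d : ℕ => (∑ j ∈ Finset.Icc 1 d, (b j)⁻¹) / (1 + Real.log d)) ''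
      Set.Ici 1)) {δ : ℝ} (hδ : 0 < δ)
    (hev : ∀ᶠ j : ℕ in atTop, δ ≤ (1 + Real.log j) * Real.log (a j) / j) :
    QPT (sobolevEmbedding a b) := by
  have hlogn : ∀ j : ℕ, 0 ≤ Real.log j := Real.log_natCast_nonneg
  obtain ⟨K, hK, hlog⟩ := exists_forall_le_add_of_eventually_le
    (u := fun j : ℕ => δ * j / (1 + Real.log j)) (v := fun j => Real.log (a j)) (by
      filter_upwards [hev, eventually_gt_atTop 0] with j hj hj0
      rw [le_div_iff₀ (by exact_mod_cast hj0)] at hj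
      rw [div_le_iff₀ (by linarith [hlogn j])]
      linarith)
  obtain ⟨B, hB⟩ := hsum
  obtain ⟨t, ht, hmain⟩ := exists_log_infoComplexity_le_mul ha ha_mono hb (abs_nonneg B)
    (show 0 ≤ (2 + K) / δ by positivity)
  refine ⟨1, t, one_pos, ht, fun d hd ε hε => ?_⟩
  have hE1 : 1 < ε⁻¹ := (one_lt_inv₀ hε.1).mpr hε.2
  have hl : 0 < Real.log ε⁻¹ := Real.log_pos hE1
  have hw : 0 < 1 + Real.log d := by linarith [hlogn d]
  have h1 := hmain d (1 + Real.log d) hw.le (by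
    rw [sum_range_succ_eq_sum_Icc (fun j => (b j)⁻¹), ← div_le_iff₀ hw]
    exact (hB ⟨d, hd, rfl⟩).trans (le_abs_self B)) ε hε fun j hj hjd hlt => by
      have h2 := Real.log_lt_log (ha j hj) hlt
      rw [Real.log_pow] at h2
      push_cast at h2
      have h3 := hlog j
      have hj0 : (0 : ℝ) < j := by exact_mod_cast hj
      -- Here `j ≤ d` is needed, to replace `1 + ln j` by the common weight `1 + ln d`.
      have h4 : δ * j / (1 + Real.log d) ≤ δ * j / (1 + Real.log j) := by
        have := hlogn j
        gcongr
      have h5 : δ * j / (1 + Real.log d) ≤ (2 + K) * (1 + Real.log ε⁻¹) := by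
        nlinarith
      rw [div_le_iff₀ hw] at h5
      rw [div_mul_eq_mul_div, div_mul_eq_mul_div, le_div_iff₀ hδ]
      linarith
  rw [Real.log_le_iff_le_exp (by linarith [one_le_infoComplexity ha hb d hε])] at h1
  refine h1.trans_eq ?_
  rw [one_mul]
  ring_nf

end PolynomialTractability

end SobolevTractability

/-! ### Assembly of the eight criteria -/

theorem theorem2p8 (a b : ℕ → ℝ)
    (ha_pos : ∀ j, 1 ≤ j → 0 < a j) (ha_mono : MonotoneOn a (Set.Ici 1))
    (hb_pos : ∀ j, 1 ≤ j → 0 < b j) (hb_inf : 0 < sInf (b '' Set.Ici 1)) :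
    -- the minimum that defines the information complexity exists
    (∀ d : ℕ, 1 ≤ d → ∀ ε ∈ Set.Ioo (0 : ℝ) 1,
      ∃ n : ℕ, minimalError (sobolevEmbedding a b d) n ≤ ENNReal.ofReal ε) ∧
    -- (i)
    ((SPT (sobolevEmbedding a b) ↔ PT (sobolevEmbedding a b)) ∧
      (PT (sobolevEmbedding a b) ↔
        Summable (fun j : ℕ => (b (j + 1))⁻¹) ∧
        0 < liminf (fun j : ℕ => ((Real.log (a j) / j : ℝ) : EReal)) atTop)) ∧
    -- (ii)
    (QPT (sobolevEmbedding a b) ↔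
      BddAbove ((fun d : ℕ => (∑ j ∈ Finset.Icc 1 d, (b j)⁻¹) / (1 + Real.log d)) '' Set.Ici 1) ∧
      0 < liminf (fun j : ℕ => (((1 + Real.log j) * Real.log (a j) / j : ℝ) : EReal)) atTop) ∧
    -- (iii)
    (UWT (sobolevEmbedding a b) ↔
      Tendsto (fun j : ℕ => Real.log (a j) / Real.log j) atTop atTop) ∧
    -- (iv)
    (WT (sobolevEmbedding a b) ↔ Tendsto (fun j : ℕ => a j / j) atTop atTop) ∧
    -- (v)
    (∀ s t : ℝ, 0 < s → 0 < t → 1 < max (s / 2) t → STWT s t (sobolevEmbedding a b)) ∧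
    -- (vi)
    (STWT 2 1 (sobolevEmbedding a b) ↔ Tendsto a atTop atTop) ∧
    -- (vii)
    (∀ t : ℝ, 0 < t → t < 1 →
      (STWT 2 t (sobolevEmbedding a b) ↔
        Tendsto (fun j : ℕ => a j / Real.log j) atTop atTop)) ∧
    -- (viii)
    (∀ s t : ℝ, 0 < s → s < 2 → 0 < t → t ≤ 1 →
      (STWT s t (sobolevEmbedding a b) ↔
        Tendsto (fun j : ℕ => a j / (j : ℝ) ^ ((2 - s) / s)) atTop atTop)) := by
  have hbβ : ∀ j, 1 ≤ j → sInf (b '' Set.Ici 1) ≤ b j := fun j hj =>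
    csInf_le ⟨0, by
      rintro _ ⟨i, hi, rfl⟩
      exact (hb_pos i hi).le⟩ ⟨j, hj, rfl⟩
  have hpt : PT (sobolevEmbedding a b) ↔ Summable (fun j : ℕ => (b (j + 1))⁻¹) ∧
      0 < liminf (fun j : ℕ => ((Real.log (a j) / j : ℝ) : EReal)) atTop := by
    rw [lt_liminf_coe_iff]
    refine ⟨fun h => h.summable_and_eventually_le ha_pos ha_mono hb_pos, ?_⟩
    rintro ⟨hsum, δ, hδ, hev⟩
    exact (spt_of_summable ha_pos ha_mono hb_pos hsum hδ hev).pt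
  have hst : ∀ s t : ℝ, 0 < s → s < 2 → 0 < t → t ≤ 1 →
      (STWT s t (sobolevEmbedding a b) ↔
        Tendsto (fun j : ℕ => a j / (j : ℝ) ^ ((2 - s) / s)) atTop atTop) :=
    fun s t hs hs2 ht ht1 =>
      ⟨tendsto_div_rpow_of_stwt ha_pos ha_mono hb_pos hs hs2.le ht1,
        stwt_of_tendsto_div_rpow ha_pos ha_mono hb_pos hb_inf hbβ hs hs2 ht⟩
  refine ⟨fun d _ ε hε => ⟨_, minimalError_ncard_freqSet_le ha_pos hb_pos d hε⟩,
    ⟨⟨SPT.pt, fun h => ?_⟩, hpt⟩, ⟨fun h => ?_, fun h => ?_⟩,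
    ⟨tendsto_log_div_log_of_uwt ha_pos ha_mono hb_pos,
      uwt_of_tendsto ha_pos ha_mono hb_pos hb_inf hbβ⟩, ?_, fun s t hs ht hmax => ?_,
    ⟨fun h => ?_, stwt_two_one_of_tendsto ha_pos ha_mono hb_pos hb_inf hbβ⟩,
    fun t ht ht1 => ⟨tendsto_div_log_of_stwt ha_pos ha_mono hb_pos ht ht1,
      stwt_two_of_tendsto_div_log ha_pos ha_mono hb_pos hb_inf hbβ ht⟩, hst⟩
  -- The conditions extracted from PT already imply SPT, which closes the equivalence.
  · obtain ⟨hsum, δ, hδ, hev⟩ := h.summable_and_eventually_le ha_pos ha_mono hb_pos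
    exact spt_of_summable ha_pos ha_mono hb_pos hsum hδ hev
  · rw [lt_liminf_coe_iff]
    exact h.bddAbove_and_eventually_le ha_pos ha_mono hb_pos
  · rw [lt_liminf_coe_iff] at h
    obtain ⟨hsum, δ, hδ, hev⟩ := h
    exact qpt_of_bddAbove ha_pos ha_mono hb_pos hsum hδ hev
  -- WT is the case `s = t = 1`, where the exponent `(2 - s)/s` is `1`.
  · rw [wt_iff_stwt_one_one, hst 1 1 one_pos one_lt_two one_pos le_rfl]
    norm_num
  · rcases lt_max_iff.mp hmax with h | h
    · exact stwt_of_two_lt_left ha_pos ha_mono hb_pos hb_inf hbβ (by linarith) ht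
    · exact stwt_of_one_lt_right ha_pos ha_mono hb_pos hb_inf hbβ hs h
  -- At `s = 2` the exponent `(2 - s)/s` vanishes and the denominator is `1`.
  · simpa using tendsto_div_rpow_of_stwt ha_pos ha_mono hb_pos two_pos le_rfl le_rfl h
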